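/- Let $\varphi$ be the first-order sentence $\forall x\,\exists y\,\forall z\,\bigl((x\sim y\wedge(y\sim z\to x\not\sim z))\vee x=z\bigr)$ over the vocabulary $\{\sim^2\}$ of graphs. For a first-order sentence $\psi$ over a finite relational vocabulary $\tau$, let $\mathrm{vd}_{\mathrm{arb}}(\psi)$ be the parameterized problem: given (an encoding of) a finite $\tau$-structure $\mathcal A$ with nonempty universe $A$ and a number $k\in\mathbb N$, with parameter $k$, is there a set $S\subseteq A$ with $|S|\le k$ such that the substructure of $\mathcal A$ induced on $A\setminus S$ satisfies $\psi$? For $\tau=\{\sim^2\}$, let $\mathrm{vd}_{\mathrm{dir}}(\psi)$, $\mathrm{vd}_{\mathrm{undir}}(\psi)$ and $\mathrm{vd}_{\mathrm{basic}}(\psi)$ be the versions in which the inputs are directed graphs, undirected graphs, and basic graphs (undirected graphs without self-loops), respectively; self-loops are allowed in directed and undirected graphs. For $c\in\{\mathrm{basic},\mathrm{undir},\mathrm{dir},\mathrm{arb}\}$ and $p\in\{a,e\}^*$, let $\mathrm{VD}_c(p)$ be the class of all problems $\mathrm{vd}_c(\psi)$ where $\psi$ is in prenex normal form with quantifier prefix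 $p$ ($a$ stands for $\forall$ and $e$ for $\exists$). Then $\mathrm{vd}_{\mathrm{basic}}(\varphi)\in\mathrm{VD}_{\mathrm{basic}}(aea)$ and $\mathrm{vd}_{\mathrm{basic}}(\varphi)$ is $\mathrm W[2]$-hard. Likewise, for each $c\in\{\mathrm{undir},\mathrm{dir},\mathrm{arb}\}$, $\mathrm{vd}_{c}(\varphi)\in\mathrm{VD}_{c}(aea)$ and $\mathrm{vd}_{c}(\varphi)$ is $\mathrm W[2]$-hard. In particular, each of the four classes $\mathrm{VD}_c(aea)$ contains a $\mathrm W[2]$-hard problem. Here $\mathrm W[2]$ is the closure under fpt many-one reductions of the weighted definability problems of $\Pi_2$-formulas $\theta(X)$ with a free relation variable $X$ of arity $r$ (given a structure $\mathcal A$ and the parameter $k$, is there $R\subseteq A^r$ with $|R|=k$ and $\mathcal A\models\theta(R)$?), and a problem is $\mathrm W[2]$-hard if every problem in $\mathrm W[2]$ has an fpt many-one reduction to it. -/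

import Mathlib

open FirstOrder

namespace VertexDeletion

/-! ### Relational vocabularies, finite structures and their encodings -/

/-- A finite relational vocabulary: `num` relation symbols, each of positive arity. -/
structure Vocab where
  num : ℕ
  arity : Fin num → ℕ
  arity_pos : ∀ i, 0 < arity i

/-- The first-order language of a relational vocabulary. -/
def Vocab.lang (τ : Vocab) : FirstOrder.Language.{0, 0} where
  Functions := fun _ => Empty
  Relations := fun r => {i : Fin τ.num // τ.arity i = r}

/-- A finite structure over `τ`; its (nonempty) universe is `{0, …, size - 1}`. -/
structure FinStruct (τ : Vocab) where
  size : ℕ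
  size_pos : 0 < size
  rel : (i : Fin τ.num) → (Fin (τ.arity i) → Fin size) → Bool

/-- The structure induced by `A` on a type `M` that is mapped into the universe of `A`. -/
@[reducible] def FinStruct.induced {τ : Vocab} (A : FinStruct τ) {M : Type} (ι : M → Fin A.size) :
    τ.lang.Structure M where
  funMap := fun f _ => nomatch f
  RelMap := fun R v => A.rel R.1 (fun j => ι (v (Fin.cast R.2 j))) = true

/-- `A ⊨ φ`. -/
def FinStruct.Models {τ : Vocab} (A : FinStruct τ) (φ : τ.lang.Sentence) : Prop :=
  @FirstOrder.Language.Sentence.Realize τ.lang (Fin A.size) (A.induced id) φ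

/-- `A ∖ S ⊨ φ`, where `A ∖ S` is the substructure of `A` induced on the complement of `S`. -/
def FinStruct.MinusModels {τ : Vocab} (A : FinStruct τ) (S : Finset (Fin A.size))
    (φ : τ.lang.Sentence) : Prop :=
  @FirstOrder.Language.Sentence.Realize τ.lang {v : Fin A.size // v ∉ S} (A.induced Subtype.val) φ

/-- The encoding of a finite structure with `n` elements as a binary word: `n` in unary (`1ⁿ0`),
followed by the truth table of each relation symbol in turn. In the table of a symbol of arity
`r`, the tuple `a` occupies position `∑ j, a j * n ^ j`. -/
def FinStruct.encode {τ : Vocab} (A : FinStruct τ) : List (Fin 2) :=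
  List.replicate A.size 1 ++ 0 ::
    (List.finRange τ.num).flatMap fun i =>
      List.ofFn fun j : Fin (A.size ^ τ.arity i) =>
        if A.rel i (finFunctionFinEquiv.symm j) then 1 else 0

/-! ### Quantifier patterns -/

/-- The two letters of quantifier patterns: `a` for `∀`, `e` for `∃`. -/
inductive Quant
  | a
  | e

/-- `HasPattern p φ`: the formula `φ` is in prenex normal form with quantifier prefix `p`. -/
inductive HasPattern {L : FirstOrder.Language.{0, 0}} :
    List Quant → {n : ℕ} → L.BoundedFormula Empty n → Prop
  | qf {n : ℕ} {φ : L.BoundedFormula Empty n} (h : φ.IsQF) : HasPattern [] φ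
  | all {n : ℕ} {p : List Quant} {φ : L.BoundedFormula Empty (n + 1)} (h : HasPattern p φ) :
      HasPattern (Quant.a :: p) φ.all
  | ex {n : ℕ} {p : List Quant} {φ : L.BoundedFormula Empty (n + 1)} (h : HasPattern p φ) :
      HasPattern (Quant.e :: p) φ.ex

/-! ### Random access machines

The machine model is a random access machine with uniform cost, whose programs are written as
while-programs. The memory consists of registers `reg r` and arrays `arr b` of natural numbers;
a program mentions only finitely many of them. There is a write-only output. The arithmetic
operations are addition, truncated subtraction, quotient and remainder, but not multiplication:
`t` steps increase the bit length of the numbers in the memory by `O(t)` only, and the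
running times are polynomially related to those of Turing machines. -/

/-- Expressions without side effects. -/
inductive Expr
  | const (c : ℕ)
  | reg (r : ℕ)
  | get (b : ℕ) (i : Expr)
  | add (e₁ e₂ : Expr)
  | sub (e₁ e₂ : Expr)
  | div (e₁ e₂ : Expr)
  | mod (e₁ e₂ : Expr)

/-- Memory and output of the machine. -/
structure State where
  reg : ℕ → ℕ
  arr : ℕ → ℕ → ℕ
  out : List ℕ

/-- The value of an expression. -/
def Expr.eval (σ : State) : Expr → ℕ
  | .const c => c
  | .reg r => σ.reg r
  | .get b i => σ.arr b (i.eval σ)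
  | .add e₁ e₂ => e₁.eval σ + e₂.eval σ
  | .sub e₁ e₂ => e₁.eval σ - e₂.eval σ
  | .div e₁ e₂ => e₁.eval σ / e₂.eval σ
  | .mod e₁ e₂ => e₁.eval σ % e₂.eval σ

/-- Programs. -/
inductive Prog
  | skip
  | assign (r : ℕ) (e : Expr)
  | store (b : ℕ) (i e : Expr)
  | write (e : Expr)
  | seq (p q : Prog)
  | ite (e : Expr) (p q : Prog)
  | loop (e : Expr) (p : Prog)

/-- `Run p σ σ' t`: started in state `σ`, the program `p` halts in state `σ'` after `t` steps.
Each assignment, output of a symbol, and evaluation of a test costs one step. -/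
inductive Run : Prog → State → State → ℕ → Prop
  | skip (σ : State) : Run .skip σ σ 1
  | assign (σ : State) (r : ℕ) (e : Expr) :
      Run (.assign r e) σ { σ with reg := Function.update σ.reg r (e.eval σ) } 1
  | store (σ : State) (b : ℕ) (i e : Expr) :
      Run (.store b i e) σ
        { σ with arr := Function.update σ.arr b
                  (Function.update (σ.arr b) (i.eval σ) (e.eval σ)) } 1
  | write (σ : State) (e : Expr) :
      Run (.write e) σ { σ with out := σ.out ++ [e.eval σ] } 1
  | seq {p q : Prog} {σ₁ σ₂ σ₃ : State} {t₁ t₂ : ℕ} (h₁ : Run p σ₁ σ₂ t₁)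
      (h₂ : Run q σ₂ σ₃ t₂) : Run (.seq p q) σ₁ σ₃ (t₁ + t₂)
  | ite_true {e : Expr} {p q : Prog} {σ σ' : State} {t : ℕ} (he : e.eval σ ≠ 0)
      (h : Run p σ σ' t) : Run (.ite e p q) σ σ' (t + 1)
  | ite_false {e : Expr} {p q : Prog} {σ σ' : State} {t : ℕ} (he : e.eval σ = 0)
      (h : Run q σ σ' t) : Run (.ite e p q) σ σ' (t + 1)
  | loop_true {e : Expr} {p : Prog} {σ₁ σ₂ σ₃ : State} {t₁ t₂ : ℕ} (he : e.eval σ₁ ≠ 0)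
      (h₁ : Run p σ₁ σ₂ t₁) (h₂ : Run (.loop e p) σ₂ σ₃ t₂) :
      Run (.loop e p) σ₁ σ₃ (t₁ + t₂ + 1)
  | loop_false {e : Expr} {p : Prog} {σ : State} (he : e.eval σ = 0) :
      Run (.loop e p) σ σ 1

/-- The initial state on input `(x, k)`: array `0` holds the word `x`, register `0` its length and
register `1` the number `k`; everything else is zero and nothing has been written. -/
def initState {s : ℕ} (x : List (Fin s)) (k : ℕ) : State where
  reg := fun r => if r = 0 then x.length else if r = 1 then k else 0
  arr := fun b i => if b = 0 then (x.map Fin.val).getD i 0 else 0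
  out := []

/-! ### Parameterized problems, fpt-reductions and the class W[2] -/

/-- A parameterized problem over an alphabet with `s` letters: a set of pairs of an input and a
parameter. -/
abbrev ParamProblem (s : ℕ) : Type := Set (List (Fin s) × ℕ)

/-- The function `f` is computable in time `h(k) * |x| ^ O(1)` for a computable function `h`.
The output word is the written word, the output parameter is left in register `1`. -/
def FptComputable {s s' : ℕ} (f : List (Fin s) × ℕ → List (Fin s') × ℕ) : Prop :=
  ∃ (p : Prog) (h : ℕ → ℕ) (c : ℕ), Computable h ∧
    ∀ (x : List (Fin s)) (k : ℕ), ∃ (σ : State) (t : ℕ),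
      Run p (initState x k) σ t ∧
      σ.out = (f (x, k)).1.map Fin.val ∧
      σ.reg 1 = (f (x, k)).2 ∧
      t ≤ h k * (x.length + 1) ^ c

/-- Many-one fpt-reducibility of `Q` to `Q'`. -/
def FptReducible {s s' : ℕ} (Q : ParamProblem s) (Q' : ParamProblem s') : Prop :=
  ∃ f : List (Fin s) × ℕ → List (Fin s') × ℕ,
    (∀ z, z ∈ Q ↔ f z ∈ Q') ∧
    (∃ g : ℕ → ℕ, Computable g ∧ ∀ z, (f z).2 ≤ g z.2) ∧
    FptComputable f

/-- The vocabulary `τ` together with a new relation symbol `X` of arity `r`, at index `0`. -/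
def Vocab.extend (τ : Vocab) (r : ℕ) (hr : 0 < r) : Vocab where
  num := τ.num + 1
  arity := Fin.cases r τ.arity
  arity_pos := Fin.cases hr τ.arity_pos

/-- The expansion `(A, S)` of the structure `A` by an interpretation `S` of the new symbol. -/
def FinStruct.expand {τ : Vocab} (A : FinStruct τ) (r : ℕ) (hr : 0 < r)
    (S : Finset (Fin r → Fin A.size)) : FinStruct (τ.extend r hr) where
  size := A.size
  size_pos := A.size_pos
  rel := Fin.cases (motive := fun i => (Fin ((τ.extend r hr).arity i) → Fin A.size) → Bool)
    (fun v : Fin r → Fin A.size => decide (v ∈ S)) A.rel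

/-- The weighted definability problem of a formula `φ(X)` with a free relation variable `X` of
arity `r`: given a structure `A` and `k`, is there a relation `S ⊆ A ^ r` with exactly `k` elements
such that `A ⊨ φ(S)`? -/
def weightedDefinability {τ : Vocab} {r : ℕ} {hr : 0 < r}
    (φ : (τ.extend r hr).lang.Sentence) : ParamProblem 2 :=
  {z | ∃ A : FinStruct τ, z.1 = A.encode ∧
    ∃ S : Finset (Fin r → Fin A.size), S.card = z.2 ∧ (A.expand r hr S).Models φ}

/-- `φ` is a `Π₂`-formula, that is, its pattern is in `a*e*`. -/
def IsPiTwo {L : FirstOrder.Language.{0, 0}} (φ : L.Sentence) : Prop :=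
  ∃ l m : ℕ, HasPattern (List.replicate l Quant.a ++ List.replicate m Quant.e) φ

/-- The class W[2]: the closure under fpt-reductions of the weighted definability problems
of `Π₂`-formulas. -/
def InWTwo {s : ℕ} (Q : ParamProblem s) : Prop :=
  ∃ (τ : Vocab) (r : ℕ) (hr : 0 < r) (φ : (τ.extend r hr).lang.Sentence),
    IsPiTwo φ ∧ FptReducible Q (weightedDefinability φ)

/-- W[2]-hardness: every problem in W[2] (over any alphabet) is fpt-reducible to `L`. -/
def IsWTwoHard {s : ℕ} (L : ParamProblem s) : Prop :=
  ∀ (s' : ℕ) (Q : ParamProblem s'), InWTwo Q → FptReducible Q L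

/-! ### Vertex deletion problems -/

/-- The vertex deletion problem of `φ` with input structures from the class `K`: given a structure
`A` in `K` and `k`, is there a set `S` of at most `k` elements of `A` with `A ∖ S ⊨ φ`? -/
def vdOn {τ : Vocab} (K : FinStruct τ → Prop) (φ : τ.lang.Sentence) : ParamProblem 2 :=
  {z | ∃ A : FinStruct τ, K A ∧ z.1 = A.encode ∧
    ∃ S : Finset (Fin A.size), S.card ≤ z.2 ∧ A.MinusModels S φ}

/-- The vocabulary of graphs: one binary relation symbol. -/
def graphVocab : Vocab where
  num := 1
  arity := fun _ => 2
  arity_pos := fun _ => Nat.two_pos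

/-- The atomic formula `t₁ ∼ t₂`. -/
def adj {n : ℕ} (t₁ t₂ : graphVocab.lang.Term (Empty ⊕ Fin n)) :
    graphVocab.lang.BoundedFormula Empty n :=
  FirstOrder.Language.Relations.boundedFormula₂ (L := graphVocab.lang) ⟨(0 : Fin 1), rfl⟩ t₁ t₂

/-- `∀ x ∀ y (x ∼ y → y ∼ x)` -/
def phiUndirected : graphVocab.lang.Sentence :=
  ∀' ∀' (adj (&0) (&1) ⟹ adj (&1) (&0))

/-- `∀ x ∀ y (x ∼ y → (y ∼ x ∧ x ≠ y))` -/
def phiBasic : graphVocab.lang.Sentence :=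
  ∀' ∀' (adj (&0) (&1) ⟹ (adj (&1) (&0) ⊓ ∼((&0) =' (&1))))

/-- `∀ x ∃ y ∀ z ((x ∼ y ∧ (y ∼ z → ¬ x ∼ z)) ∨ x = z)` -/
def phiAEA : graphVocab.lang.Sentence :=
  ∀' ∃' ∀' ((adj (&0) (&1) ⊓ (adj (&1) (&2) ⟹ ∼(adj (&0) (&2)))) ⊔ ((&0) =' (&2)))

/-- The problem on basic graphs (undirected graphs without self-loops). -/
def vdBasic (φ : graphVocab.lang.Sentence) : ParamProblem 2 :=
  vdOn (fun G => G.Models phiBasic) φ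

/-- The problem on undirected graphs (self-loops are allowed). -/
def vdUndir (φ : graphVocab.lang.Sentence) : ParamProblem 2 :=
  vdOn (fun G => G.Models phiUndirected) φ

/-- The problem on directed graphs (self-loops are allowed). -/
def vdDir (φ : graphVocab.lang.Sentence) : ParamProblem 2 :=
  vdOn (fun _ => True) φ

/-- The problem on arbitrary structures, over an arbitrary vocabulary. -/
def vdArb {τ : Vocab} (φ : τ.lang.Sentence) : ParamProblem 2 :=
  vdOn (fun _ => True) φ

/-- The problems `vdBasic φ` for the formulas `φ` with pattern `p`. -/
def classBasic (p : List Quant) : Set (ParamProblem 2) :=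
  {L | ∃ φ : graphVocab.lang.Sentence, HasPattern p φ ∧ L = vdBasic φ}

/-- The problems `vdUndir φ` for the formulas `φ` with pattern `p`. -/
def classUndir (p : List Quant) : Set (ParamProblem 2) :=
  {L | ∃ φ : graphVocab.lang.Sentence, HasPattern p φ ∧ L = vdUndir φ}

/-- The problems `vdDir φ` for the formulas `φ` with pattern `p`. -/
def classDir (p : List Quant) : Set (ParamProblem 2) :=
  {L | ∃ φ : graphVocab.lang.Sentence, HasPattern p φ ∧ L = vdDir φ}

/-- The problems `vdArb φ` for the formulas `φ`, over any vocabulary, with pattern `p`. -/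
def classArb (p : List Quant) : Set (ParamProblem 2) :=
  {L | ∃ (τ : Vocab) (φ : τ.lang.Sentence), HasPattern p φ ∧ L = vdArb φ}

end VertexDeletion

/-! The weighted definability problem of an arbitrary Π₂-formula is reduced to a hitting set
problem, and this to vertex deletion on basic graphs. Basic graphs lie in all four input classes, so
one reduction serves every case.

On a loop-free undirected graph with at least two vertices, `phiAEA` says that every vertex lies on
an edge that is in no triangle. In the gadget graph an element of the set system is an edge, and a
set is a vertex joined to both ends of each of its elements. Thus all edges at a set vertex are in
triangles until one end of some element of the set is deleted. Hubs provide all other vertices with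
an edge in no triangle, and each set is repeated so often that the budget cannot remove all its
copies (`exists_satAEA_iff`).

For the hitting set problem, a relation with `k` tuples is represented by a chain `s 0 < ⋯ < s (k +
1)` whose inner terms are the codes of the tuples plus one. An element of the set system codes `Q`
pairs of an index and a value, and the budget `(k + 2) ^ Q` pays for one code per tuple of `Q`
indices. The sets `ChainSet` force exactly one code for each index tuple, and force the selected
codes to be pairwise compatible; then all of them are excerpts of one chain
(`exists_chain_of_hitting`).

The sorted form is what copes with negation: two consecutive terms of the chain around the code of a
tuple decide whether the tuple is in the relation (`hasValue_iff`). So a number `q` of indices,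
depending on the formula only, determines the truth value of its quantifier-free part. For each
assignment of the universal variables there is a further set, consisting of the codes that certify
the formula for some choice of the existential variables. Hitting all of these sets expresses the
∀∃-formula (`exists_hitting_iff`).

The running time is handled by a language of terms with arithmetic and bounded sums, which compile
to polynomial-time programs (`Tm.run_compile`). The output word of the reduction is described by
such terms, and `FptReducible.trans_terms` appends it to a given fpt-reduction. -/

namespace VertexDeletion

/-! ### Loops -/

/-- A loop whose body preserves an invariant `inv` and is executed `n` times. -/
theorem run_loop_of_inv {e : Expr} {p : Prog} {n C : ℕ} {inv : ℕ → State → Prop}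
    (hstep : ∀ i < n, ∀ σ, inv i σ → e.eval σ ≠ 0 ∧
      ∃ σ' t, Run p σ σ' t ∧ t ≤ C ∧ inv (i + 1) σ')
    (hend : ∀ σ, inv n σ → e.eval σ = 0) {σ : State} (h0 : inv 0 σ) :
    ∃ σ' t, Run (.loop e p) σ σ' t ∧ t ≤ n * (C + 1) + 1 ∧ inv n σ' := by
  have key : ∀ j i σ, i + j = n → inv i σ →
      ∃ σ' t, Run (.loop e p) σ σ' t ∧ t ≤ j * (C + 1) + 1 ∧ inv n σ' := by
    intro j
    induction j with
    | zero =>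
      intro i σ hi h
      obtain rfl : i = n := by omega
      exact ⟨σ, 1, .loop_false (hend σ h), by omega, h⟩
    | succ j ih =>
      intro i σ hi h
      obtain ⟨he, σ₁, t₁, r₁, ht₁, h₁⟩ := hstep i (by omega) σ h
      obtain ⟨σ₂, t₂, r₂, ht₂, h₂⟩ := ih (i + 1) σ₁ (by omega) h₁
      refine ⟨σ₂, _, .loop_true he r₁ r₂, ?_, h₂⟩
      rw [Nat.succ_mul]
      omega
  exact key n 0 σ (by omega) h0

/-! ### A language of terms with bounded sums -/

/-- The binary operations of the machine. -/
inductive BinOp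
  | add
  | sub
  | div
  | mod

def BinOp.eval : BinOp → ℕ → ℕ → ℕ
  | .add, x, y => x + y
  | .sub, x, y => x - y
  | .div, x, y => x / y
  | .mod, x, y => x % y

def BinOp.toExpr : BinOp → Expr → Expr → Expr
  | .add => .add
  | .sub => .sub
  | .div => .div
  | .mod => .mod

theorem BinOp.eval_toExpr (o : BinOp) (e₁ e₂ : Expr) (σ : State) :
    (o.toExpr e₁ e₂).eval σ = o.eval (e₁.eval σ) (e₂.eval σ) := by
  cases o <;> rfl

theorem BinOp.eval_le (o : BinOp) (x y : ℕ) : o.eval x y ≤ x + y := by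
  cases o
  · exact le_rfl
  · exact (Nat.sub_le x y).trans (Nat.le_add_right x y)
  · exact (Nat.div_le_self x y).trans (Nat.le_add_right x y)
  · exact (Nat.mod_le x y).trans (Nat.le_add_right x y)

/-- Terms over an array (`get`) and de Bruijn variables; `sum t₁ t₂` is `∑ i < t₁, t₂ i`. -/
inductive Tm
  | const (c : ℕ)
  | var (i : ℕ)
  | get (t : Tm)
  | bin (o : BinOp) (t₁ t₂ : Tm)
  | sum (t₁ t₂ : Tm)

/-- The environment `ρ` with a new innermost value. -/
def push {β : Type} (x : β) (ρ : ℕ → β) : ℕ → β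
  | 0 => x
  | j + 1 => ρ j

/-- The value of a term with respect to the array `w` and the environment `ρ`. -/
def Tm.eval (w : ℕ → ℕ) : Tm → (ℕ → ℕ) → ℕ
  | .const c, _ => c
  | .var i, ρ => ρ i
  | .get t, ρ => w (t.eval w ρ)
  | .bin o t₁ t₂, ρ => o.eval (t₁.eval w ρ) (t₂.eval w ρ)
  | .sum t₁ t₂, ρ => ∑ i ∈ Finset.range (t₁.eval w ρ), t₂.eval w (push i ρ)

/-- The body of the loop that computes a sum: limit, accumulator and counter are the registers
`d`, `d + 1` and `d + 2`. -/
def sumBody (d : ℕ) (p : Prog) : Prog :=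
  .seq p (.seq (.assign (d + 1) (.add (.reg (d + 1)) (.reg (d + 3))))
    (.assign (d + 2) (.add (.reg (d + 2)) (.const 1))))

/-- A program that computes a term. The array is `b`, the variables are in the registers given by
`m`, and the result is left in register `d`. -/
def Tm.compile (b : ℕ) : Tm → (ℕ → ℕ) → ℕ → Prog
  | .const c, _, d => .assign d (.const c)
  | .var i, m, d => .assign d (.reg (m i))
  | .get t, m, d => .seq (t.compile b m d) (.assign d (.get b (.reg d)))
  | .bin o t₁ t₂, m, d => .seq (t₁.compile b m d) (.seq (t₂.compile b m (d + 1))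
      (.assign d (o.toExpr (.reg d) (.reg (d + 1)))))
  | .sum t₁ t₂, m, d => .seq (t₁.compile b m d) (.seq (.assign (d + 1) (.const 0))
      (.seq (.assign (d + 2) (.const 0))
      (.seq (.loop (.sub (.reg d) (.reg (d + 2)))
          (sumBody d (t₂.compile b (push (d + 2) m) (d + 3))))
        (.assign d (.reg (d + 1))))))

theorem push_le {ρ : ℕ → ℕ} {s x : ℕ} (hx : x ≤ s) (hρ : ∀ i, ρ i ≤ s) (i : ℕ) :
    push x ρ i ≤ s := by
  cases i
  · exact hx
  · exact hρ _

/-- Values of terms are polynomially bounded. -/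
theorem Tm.eval_le (t : Tm) : ∃ c, ∀ (w ρ : ℕ → ℕ) (s : ℕ), 2 ≤ s → (∀ i, w i ≤ s) →
    (∀ i, ρ i ≤ s) → t.eval w ρ ≤ s ^ c := by
  induction t with
  | const c =>
    refine ⟨c, fun w ρ s hs _ _ => ?_⟩
    exact Nat.lt_two_pow_self.le.trans (Nat.pow_le_pow_left hs c)
  | var i => exact ⟨1, fun w ρ s _ _ hρ => by simpa [Tm.eval] using hρ i⟩
  | get t => exact ⟨1, fun w ρ s _ hw _ => by simpa [Tm.eval] using hw _⟩
  | bin o t₁ t₂ ih₁ ih₂ =>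
    obtain ⟨c₁, h₁⟩ := ih₁
    obtain ⟨c₂, h₂⟩ := ih₂
    refine ⟨max c₁ c₂ + 1, fun w ρ s hs hw hρ => ?_⟩
    have hs1 : 1 ≤ s := by omega
    calc _ ≤ _ := o.eval_le _ _
      _ ≤ s ^ max c₁ c₂ + s ^ max c₁ c₂ :=
        add_le_add ((h₁ w ρ s hs hw hρ).trans (Nat.pow_le_pow_right hs1 (le_max_left _ _)))
          ((h₂ w ρ s hs hw hρ).trans (Nat.pow_le_pow_right hs1 (le_max_right _ _)))
      _ = s ^ max c₁ c₂ * 2 := by ring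
      _ ≤ s ^ (max c₁ c₂ + 1) := by rw [pow_succ]; exact Nat.mul_le_mul_left _ hs
  | sum t₁ t₂ ih₁ ih₂ =>
    obtain ⟨c₁, h₁⟩ := ih₁
    obtain ⟨c₂, h₂⟩ := ih₂
    -- The summation index may reach `s ^ c₁`, so the body is estimated with `s ^ (c₁ + 1)` in place
    -- of `s`.
    refine ⟨c₁ + (c₁ + 1) * c₂, fun w ρ s hs hw hρ => ?_⟩
    have hs1 : s ≤ s ^ (c₁ + 1) := Nat.le_self_pow (by omega) s
    have h1 := h₁ w ρ s hs hw hρ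
    have h2 : ∀ i ∈ Finset.range (t₁.eval w ρ),
        t₂.eval w (push i ρ) ≤ (s ^ (c₁ + 1)) ^ c₂ := by
      intro i hi
      refine h₂ w _ _ (hs.trans hs1) (fun j => (hw j).trans hs1)
        (push_le ?_ fun j => (hρ j).trans hs1)
      exact ((Finset.mem_range.1 hi).le.trans h1).trans
        (Nat.pow_le_pow_right (by omega) (by omega))
    calc _ ≤ (Finset.range (t₁.eval w ρ)).card • (s ^ (c₁ + 1)) ^ c₂ :=
          Finset.sum_le_card_nsmul _ _ _ h2
      _ = t₁.eval w ρ * (s ^ (c₁ + 1)) ^ c₂ := by simp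
      _ ≤ s ^ c₁ * (s ^ (c₁ + 1)) ^ c₂ := Nat.mul_le_mul_right _ h1
      _ = _ := by rw [pow_add s c₁ (_ * _), pow_mul]

/-- `σ'` differs from `σ` in the registers from `d` on only. -/
def Keeps (d : ℕ) (σ σ' : State) : Prop :=
  (∀ r < d, σ'.reg r = σ.reg r) ∧ σ'.arr = σ.arr ∧ σ'.out = σ.out

theorem Keeps.trans {d : ℕ} {σ₁ σ₂ σ₃ : State} (h : Keeps d σ₁ σ₂) (h' : Keeps d σ₂ σ₃) :
    Keeps d σ₁ σ₃ :=
  ⟨fun r hr => (h'.1 r hr).trans (h.1 r hr), h'.2.1.trans h.2.1, h'.2.2.trans h.2.2⟩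

theorem Keeps.mono {d d' : ℕ} (hd : d ≤ d') {σ σ' : State} (h : Keeps d' σ σ') : Keeps d σ σ' :=
  ⟨fun r hr => h.1 r (hr.trans_le hd), h.2⟩

theorem Keeps.assign {d r : ℕ} (hr : d ≤ r) (σ : State) (x : ℕ) :
    Keeps d σ { σ with reg := Function.update σ.reg r x } :=
  ⟨fun _ hq => Function.update_of_ne (by omega) _ _, rfl, rfl⟩

/-- Correctness of the compiled programs, and a polynomial bound on their running times. -/
theorem Tm.run_compile (t : Tm) : ∃ c, ∀ (b : ℕ) (m : ℕ → ℕ) (d : ℕ) (w ρ : ℕ → ℕ) (s : ℕ)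
    (σ : State), 2 ≤ s → (∀ i, w i ≤ s) → (∀ i, ρ i ≤ s) → (∀ i, m i < d) →
    (∀ i, σ.reg (m i) = ρ i) → σ.arr b = w →
    ∃ σ' τ, Run (t.compile b m d) σ σ' τ ∧ τ ≤ s ^ c ∧ σ'.reg d = t.eval w ρ ∧
      Keeps d σ σ' := by
  induction t with
  | const c =>
    refine ⟨0, fun b m d w ρ s σ _ _ _ _ _ _ => ⟨_, 1, .assign _ _ _, by simp, ?_,
      Keeps.assign le_rfl _ _⟩⟩
    simp [Tm.eval, Expr.eval]
  | var i =>
    refine ⟨0, fun b m d w ρ s σ _ _ _ _ hm _ => ⟨_, 1, .assign _ _ _, by simp, ?_,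
      Keeps.assign le_rfl _ _⟩⟩
    simp [Tm.eval, Expr.eval, hm]
  | get t ih =>
    obtain ⟨c, h⟩ := ih
    refine ⟨c + 1, fun b m d w ρ s σ hs hw hρ hm hσ hb => ?_⟩
    obtain ⟨σ₁, t₁, r₁, ht₁, hd₁, k₁⟩ := h b m d w ρ s σ hs hw hρ hm hσ hb
    refine ⟨_, _, .seq r₁ (.assign _ _ _), ?_, ?_, k₁.trans (Keeps.assign le_rfl _ _)⟩
    · have := Nat.mul_le_mul_left (s ^ c) hs
      have := Nat.one_le_pow c s (by omega)
      rw [pow_succ]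
      omega
    · simp [Tm.eval, Expr.eval, hd₁, k₁.2.1, hb]
  | bin o t₁ t₂ ih₁ ih₂ =>
    obtain ⟨c₁, h₁⟩ := ih₁
    obtain ⟨c₂, h₂⟩ := ih₂
    refine ⟨max c₁ c₂ + 2, fun b m d w ρ s σ hs hw hρ hm hσ hb => ?_⟩
    obtain ⟨σ₁, τ₁, r₁, ht₁, hd₁, k₁⟩ := h₁ b m d w ρ s σ hs hw hρ hm hσ hb
    obtain ⟨σ₂, τ₂, r₂, ht₂, hd₂, k₂⟩ := h₂ b m (d + 1) w ρ s σ₁ hs hw hρ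
      (fun i => (hm i).trans (by omega)) (fun i => (k₁.1 _ (hm i)).trans (hσ i))
      ((congrFun k₁.2.1 b).trans hb)
    refine ⟨_, _, .seq r₁ (.seq r₂ (.assign _ _ _)), ?_, ?_,
      (k₁.trans (k₂.mono (by omega))).trans (Keeps.assign le_rfl _ _)⟩
    · have e1 : τ₁ ≤ s ^ max c₁ c₂ :=
        ht₁.trans (Nat.pow_le_pow_right (by omega) (le_max_left _ _))
      have e2 : τ₂ ≤ s ^ max c₁ c₂ :=
        ht₂.trans (Nat.pow_le_pow_right (by omega) (le_max_right _ _))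
      have e3 := Nat.one_le_pow (max c₁ c₂) s (by omega)
      have e4 : s ^ max c₁ c₂ * 4 ≤ s ^ max c₁ c₂ * s ^ 2 := Nat.mul_le_mul_left _ (by nlinarith)
      rw [pow_add]
      omega
    · simp [Tm.eval, Expr.eval, BinOp.eval_toExpr, hd₂, k₂.1 d (by omega), hd₁]
  | sum t₁ t₂ ih₁ ih₂ =>
    obtain ⟨c₁', h₁⟩ := ih₁
    obtain ⟨c₁, e₁⟩ := t₁.eval_le
    obtain ⟨c₂, h₂⟩ := ih₂
    -- `s ^ a` bounds the number of iterations, the time to compute it, and `s` itself, hence also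
    -- the environment of the body. Three spare factors in the exponent `a * (c₂ + 4)` absorb the
    -- constant overheads.
    set a := max c₁ c₁' + 1 with ha
    refine ⟨a * (c₂ + 4), fun b m d w ρ s σ hs hw hρ hm hσ hb => ?_⟩
    have hsa : s ≤ s ^ a := Nat.le_self_pow (by omega) s
    obtain ⟨σ₁, τ₁, r₁, ht₁, hd₁, k₁⟩ := h₁ b m d w ρ s σ hs hw hρ hm hσ hb
    have hn : t₁.eval w ρ ≤ s ^ a :=
      (e₁ w ρ s hs hw hρ).trans (Nat.pow_le_pow_right (by omega) (by omega))
    have ht₁' : τ₁ ≤ s ^ a := ht₁.trans (Nat.pow_le_pow_right (by omega) (by omega))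
    set n := t₁.eval w ρ with hn'
    set σ₂ : State := { σ₁ with reg := Function.update σ₁.reg (d + 1) 0 } with hσ₂
    set σ₃ : State := { σ₂ with reg := Function.update σ₂.reg (d + 2) 0 } with hσ₃
    have k₃ : Keeps d σ σ₃ := (k₁.trans (Keeps.assign (by omega) _ _)).trans
      (Keeps.assign (by omega) _ _)
    obtain ⟨σ₄, τ₄, r₄, ht₄, k₄, hl₄, hacc₄, hi₄⟩ := run_loop_of_inv
      (e := .sub (.reg d) (.reg (d + 2)))
      (p := sumBody d (t₂.compile b (push (d + 2) m) (d + 3))) (n := n) (C := (s ^ a) ^ c₂ + 2)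
      (inv := fun i σ' => Keeps d σ σ' ∧ σ'.reg d = n ∧
        σ'.reg (d + 1) = ∑ j ∈ Finset.range i, t₂.eval w (push j ρ) ∧ σ'.reg (d + 2) = i)
      (by
        rintro i hi σ' ⟨k, hl, hacc, hc⟩
        refine ⟨by simp only [Expr.eval, hl, hc]; omega, ?_⟩
        obtain ⟨σ₅, τ₅, r₅, ht₅, hd₅, k₅⟩ := h₂ b (push (d + 2) m) (d + 3) w (push i ρ) (s ^ a) σ'
          (hs.trans hsa) (fun j => (hw j).trans hsa)
          (push_le (hi.le.trans hn) fun j => (hρ j).trans hsa)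
          (by
            rintro (_ | j)
            · exact Nat.lt_succ_self _
            · exact (hm j).trans (by omega))
          (by
            rintro (_ | j)
            · exact hc
            · exact (k.1 _ (hm j)).trans (hσ j))
          ((congrFun k.2.1 b).trans hb)
        refine ⟨_, _, .seq r₅ (.seq (.assign _ _ _) (.assign _ _ _)), by omega, ?_, ?_, ?_, ?_⟩
        · exact ((k.trans (k₅.mono (by omega))).trans (Keeps.assign (by omega) _ _)).trans
            (Keeps.assign (by omega) _ _)
        · simp [k₅.1 d (by omega), hl]
        · simp [Expr.eval, k₅.1 (d + 1) (by omega), hacc, hd₅, Finset.sum_range_succ]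
        · simp [Expr.eval, k₅.1 (d + 2) (by omega), hc])
      (by
        rintro σ' ⟨_, hl, _, hc⟩
        simp [Expr.eval, hl, hc])
      (σ := σ₃) ⟨k₃, by simp [hσ₃, hσ₂, hd₁], by simp [hσ₃, hσ₂], by simp [hσ₃]⟩
    refine ⟨_, _, .seq r₁ (.seq (.assign _ _ _) (.seq (.assign _ _ _) (.seq r₄
      (.assign _ _ _)))), ?_, ?_, k₄.trans (Keeps.assign le_rfl _ _)⟩
    · have f1 : n * ((s ^ a) ^ c₂ + 2 + 1) ≤ s ^ a * ((s ^ a) ^ c₂ + 2 + 1) :=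
        Nat.mul_le_mul_right _ hn
      have f2 : 1 ≤ (s ^ a) ^ c₂ := Nat.one_le_pow _ _ (by omega)
      have f3 : 2 ≤ s ^ a := hs.trans hsa
      have f4 : s ^ a ≤ s ^ a * (s ^ a) ^ c₂ := Nat.le_mul_of_pos_right _ f2
      have f5 : 8 ≤ (s ^ a) ^ 3 := Nat.pow_le_pow_left f3 3
      have f6 : s ^ a * (s ^ a) ^ c₂ * 8 ≤ s ^ a * (s ^ a) ^ c₂ * (s ^ a) ^ 3 :=
        Nat.mul_le_mul_left _ f5
      have f7 : s ^ (a * (c₂ + 4)) = s ^ a * (s ^ a) ^ c₂ * (s ^ a) ^ 3 := by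
        rw [pow_mul]; ring
      rw [f7]
      have f8 : s ^ a * ((s ^ a) ^ c₂ + 2 + 1) = s ^ a * (s ^ a) ^ c₂ + 3 * s ^ a := by ring
      omega
    · simp [Tm.eval, Expr.eval, hacc₄, hn']

/-! ### Redirecting the output of a program to an array -/

/-- The registers and arrays that an expression mentions are below this number. -/
def Expr.fresh : Expr → ℕ
  | .const _ => 0
  | .reg r => r + 1
  | .get b i => max (b + 1) i.fresh
  | .add e₁ e₂ | .sub e₁ e₂ | .div e₁ e₂ | .mod e₁ e₂ => max e₁.fresh e₂.fresh

/-- The registers and arrays that a program mentions are below this number. -/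
def Prog.fresh : Prog → ℕ
  | .skip => 0
  | .assign r e => max (r + 1) e.fresh
  | .store b i e => max (b + 1) (max i.fresh e.fresh)
  | .write e => e.fresh
  | .seq p q => max p.fresh q.fresh
  | .ite e p q => max e.fresh (max p.fresh q.fresh)
  | .loop e p => max e.fresh p.fresh

/-- The program that writes its output into array `F`, and the length of the output into
register `F`. -/
def Prog.redirect (F : ℕ) : Prog → Prog
  | .skip => .skip
  | .assign r e => .assign r e
  | .store b i e => .store b i e
  | .write e => .seq (.store F (.reg F) e) (.assign F (.add (.reg F) (.const 1)))
  | .seq p q => .seq (p.redirect F) (q.redirect F)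
  | .ite e p q => .ite e (p.redirect F) (q.redirect F)
  | .loop e p => .loop e (p.redirect F)

/-- `τ` agrees with `σ` below `F`, and holds the output of `σ` in array `F`. -/
structure Redirected (F : ℕ) (σ τ : State) : Prop where
  reg : ∀ r < F, τ.reg r = σ.reg r
  arr : ∀ b < F, τ.arr b = σ.arr b
  word : ∀ i, τ.arr F i = σ.out.getD i 0
  length : τ.reg F = σ.out.length
  out : τ.out = []

theorem Redirected.eval_eq {F : ℕ} {σ τ : State} (h : Redirected F σ τ) (e : Expr)
    (he : e.fresh ≤ F) : e.eval τ = e.eval σ := by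
  induction e with
  | const c => rfl
  | reg r => exact h.reg r he
  | get b i ih =>
    simp only [Expr.fresh, max_le_iff] at he
    simp only [Expr.eval, ih he.2, h.arr b he.1]
  | add e₁ e₂ ih₁ ih₂ | sub e₁ e₂ ih₁ ih₂ | div e₁ e₂ ih₁ ih₂ | mod e₁ e₂ ih₁ ih₂ =>
    simp only [Expr.fresh, max_le_iff] at he
    simp only [Expr.eval, ih₁ he.1, ih₂ he.2]

/-- A write turns into a store and an assignment, whence the factor 2. Nothing else changes, since
the program mentions no register or array from `F` on. -/
theorem Run.redirect {F : ℕ} {p : Prog} {σ σ' : State} {t : ℕ} (h : Run p σ σ' t)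
    (hF : p.fresh ≤ F) {τ : State} (hτ : Redirected F σ τ) :
    ∃ τ' t', Run (p.redirect F) τ τ' t' ∧ t' ≤ 2 * t ∧ Redirected F σ' τ' := by
  induction h generalizing τ with
  | skip σ => exact ⟨τ, 1, .skip τ, by omega, hτ⟩
  | assign σ r e =>
    simp only [Prog.fresh, max_le_iff] at hF
    refine ⟨_, 1, .assign _ _ _, by omega, fun q hq => ?_, hτ.arr, hτ.word, ?_, hτ.out⟩
    · simp only [hτ.eval_eq e hF.2, Function.update_apply, hτ.reg q hq]
    · simp only [Function.update_apply, hτ.length]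
      rw [if_neg (by omega)]
  | store σ b i e =>
    simp only [Prog.fresh, max_le_iff] at hF
    refine ⟨_, 1, .store _ _ _ _, by omega, hτ.reg, fun q hq => ?_, ?_, hτ.length, hτ.out⟩
    · simp only [hτ.eval_eq e hF.2.2, hτ.eval_eq i hF.2.1, hτ.arr b hF.1, Function.update_apply,
        hτ.arr q hq]
    · intro j
      simp only
      rw [Function.update_of_ne (by omega)]
      exact hτ.word j
  | write σ e =>
    simp only [Prog.fresh] at hF
    refine ⟨_, 2, .seq (.store _ _ _ _) (.assign _ _ _), by omega, fun q hq => ?_, fun q hq => ?_,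
      fun j => ?_, ?_, hτ.out⟩
    · simp only
      rw [Function.update_of_ne (by omega)]
      exact hτ.reg q hq
    · simp only
      rw [Function.update_of_ne (by omega)]
      exact hτ.arr q hq
    · simp only [Function.update_self, Expr.eval, hτ.length, hτ.eval_eq e hF, Function.update_apply]
      split_ifs with hj
      · simp [hj]
      · rw [hτ.word j]
        rcases lt_or_gt_of_ne hj with h | h
        · rw [List.getD_append _ _ _ _ h]
        · rw [List.getD_eq_default _ _ (by omega), List.getD_eq_default _ _ (by simp; omega)]
    · simp [Expr.eval, hτ.length]
  | seq h₁ h₂ ih₁ ih₂ =>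
    simp only [Prog.fresh, max_le_iff] at hF
    obtain ⟨τ₁, t₁, r₁, b₁, k₁⟩ := ih₁ hF.1 hτ
    obtain ⟨τ₂, t₂, r₂, b₂, k₂⟩ := ih₂ hF.2 k₁
    exact ⟨τ₂, _, .seq r₁ r₂, by omega, k₂⟩
  | ite_true he h ih =>
    simp only [Prog.fresh, max_le_iff] at hF
    obtain ⟨τ₁, t₁, r₁, b₁, k₁⟩ := ih hF.2.1 hτ
    exact ⟨τ₁, _, .ite_true (by rwa [hτ.eval_eq _ hF.1]) r₁, by omega, k₁⟩
  | ite_false he h ih =>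
    simp only [Prog.fresh, max_le_iff] at hF
    obtain ⟨τ₁, t₁, r₁, b₁, k₁⟩ := ih hF.2.2 hτ
    exact ⟨τ₁, _, .ite_false (by rwa [hτ.eval_eq _ hF.1]) r₁, by omega, k₁⟩
  | loop_true he h₁ h₂ ih₁ ih₂ =>
    have hF' := hF
    simp only [Prog.fresh, max_le_iff] at hF
    obtain ⟨τ₁, t₁, r₁, b₁, k₁⟩ := ih₁ hF.2 hτ
    obtain ⟨τ₂, t₂, r₂, b₂, k₂⟩ := ih₂ hF' k₁
    exact ⟨τ₂, _, .loop_true (by rwa [hτ.eval_eq _ hF.1]) r₁ r₂, by omega, k₂⟩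
  | loop_false he =>
    simp only [Prog.fresh, max_le_iff] at hF
    exact ⟨τ, 1, .loop_false (by rwa [hτ.eval_eq _ hF.1]), by omega, hτ⟩

theorem redirected_initState {s : ℕ} {F : ℕ} (hF : 2 ≤ F) (x : List (Fin s)) (k : ℕ) :
    Redirected F (initState x k) (initState x k) where
  reg _ _ := rfl
  arr _ _ := rfl
  word i := by
    simp only [initState, List.getD_nil]
    rw [if_neg (by omega)]
  length := by
    simp only [initState, List.length_nil]
    rw [if_neg (by omega), if_neg (by omega)]
  out := rfl

/-- Each step writes at most one letter. This bounds the length of the intermediate word in a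
composition of reductions. -/
theorem Run.length_out_le {p : Prog} {σ σ' : State} {t : ℕ} (h : Run p σ σ' t) :
    σ'.out.length ≤ σ.out.length + t := by
  induction h with
  | write => simp
  | seq | loop_true | ite_true | ite_false => omega
  | _ => simp

/-! ### Functions and relations that are given by terms -/

/-- A type whose elements provide a word and an environment for the evaluation of terms. -/
class Ctx (α : Type) where
  word : α → ℕ → ℕ
  env : α → ℕ → ℕ

/-- The context `α` with one more variable. -/
structure Ext (α : Type) where
  fst : α
  snd : ℕ

instance {α : Type} [Ctx α] : Ctx (Ext α) where
  word p := Ctx.word p.fst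
  env p := push p.snd (Ctx.env p.fst)

/-- The context of the inputs of parameterized problems: the word, its length and the parameter. -/
instance {s : ℕ} : Ctx (List (Fin s) × ℕ) where
  word z i := (z.1.map Fin.val).getD i 0
  env z := push z.1.length fun _ => z.2

/-- The function `f` is given by a term. -/
def TmFun {α : Type} [Ctx α] (f : α → ℕ) : Prop :=
  ∃ t : Tm, ∀ a, t.eval (Ctx.word a) (Ctx.env a) = f a

/-- The relation `p` is given by a term. -/
def TmRel {α : Type} [Ctx α] (p : α → Prop) : Prop :=
  ∃ f : α → ℕ, TmFun f ∧ ∀ a, p a ↔ f a ≠ 0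

/-- Renaming of variables. -/
def Tm.rename : (ℕ → ℕ) → Tm → Tm
  | _, .const c => .const c
  | m, .var i => .var (m i)
  | m, .get t => .get (t.rename m)
  | m, .bin o t₁ t₂ => .bin o (t₁.rename m) (t₂.rename m)
  | m, .sum t₁ t₂ => .sum (t₁.rename m) (t₂.rename (push 0 fun i => m i + 1))

theorem Tm.eval_rename (w : ℕ → ℕ) (t : Tm) (m ρ : ℕ → ℕ) :
    (t.rename m).eval w ρ = t.eval w fun i => ρ (m i) := by
  induction t generalizing m ρ with
  | const | var => rfl
  | get t ih => simp only [Tm.rename, Tm.eval, ih]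
  | bin o t₁ t₂ ih₁ ih₂ => simp only [Tm.rename, Tm.eval, ih₁, ih₂]
  | sum t₁ t₂ ih₁ ih₂ =>
    simp only [Tm.rename, Tm.eval, ih₁, ih₂]
    refine Finset.sum_congr rfl fun i _ => congrArg _ (funext ?_)
    rintro (_ | j) <;> rfl

/-! ### Closure of term-definable functions and relations under arithmetic, connectives and bounded
quantifiers -/

section closure

variable {α : Type} [Ctx α] {f g : α → ℕ} {p q : α → Prop}

namespace TmFun

theorem congr (hf : TmFun f) (h : ∀ a, f a = g a) : TmFun g :=
  (funext h : f = g) ▸ hf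

theorem const (c : ℕ) : TmFun fun _ : α => c := ⟨.const c, fun _ => rfl⟩

theorem snd : TmFun fun a : Ext α => a.snd := ⟨.var 0, fun _ => rfl⟩

theorem length {s : ℕ} : TmFun fun z : List (Fin s) × ℕ => z.1.length := ⟨.var 0, fun _ => rfl⟩

theorem param {s : ℕ} : TmFun fun z : List (Fin s) × ℕ => z.2 := ⟨.var 1, fun _ => rfl⟩

theorem weaken (hf : TmFun f) : TmFun fun a : Ext α => f a.fst := by
  obtain ⟨t, ht⟩ := hf
  exact ⟨t.rename (· + 1), fun a => (t.eval_rename _ _ _).trans (ht a.fst)⟩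

theorem word (hf : TmFun f) : TmFun fun a => Ctx.word a (f a) := by
  obtain ⟨t, ht⟩ := hf
  exact ⟨.get t, fun a => congrArg _ (ht a)⟩

theorem bin (o : BinOp) (hf : TmFun f) (hg : TmFun g) : TmFun fun a => o.eval (f a) (g a) := by
  obtain ⟨t, ht⟩ := hf
  obtain ⟨u, hu⟩ := hg
  exact ⟨.bin o t u, fun a => congrArg₂ _ (ht a) (hu a)⟩

theorem add (hf : TmFun f) (hg : TmFun g) : TmFun fun a => f a + g a := hf.bin .add hg

theorem sub (hf : TmFun f) (hg : TmFun g) : TmFun fun a => f a - g a := hf.bin .sub hg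

theorem div (hf : TmFun f) (hg : TmFun g) : TmFun fun a => f a / g a := hf.bin .div hg

theorem mod (hf : TmFun f) (hg : TmFun g) : TmFun fun a => f a % g a := hf.bin .mod hg

theorem sum {g : α → ℕ → ℕ} (hf : TmFun f) (hg : TmFun fun a : Ext α => g a.fst a.snd) :
    TmFun fun a => ∑ i ∈ Finset.range (f a), g a i := by
  obtain ⟨t, ht⟩ := hf
  obtain ⟨u, hu⟩ := hg
  refine ⟨.sum t u, fun a => ?_⟩
  simp only [Tm.eval, ht]
  exact Finset.sum_congr rfl fun i _ => hu ⟨a, i⟩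

/-- The machine does not multiply, so a product is a bounded sum of a constant. -/
theorem mul (hf : TmFun f) (hg : TmFun g) : TmFun fun a => f a * g a :=
  (hf.sum (g := fun a _ => g a) hg.weaken).congr fun a => by simp

theorem pow (hf : TmFun f) (c : ℕ) : TmFun fun a => f a ^ c := by
  induction c with
  | zero => exact (const 1).congr fun a => by simp
  | succ c ih => exact (ih.mul hf).congr fun a => by rw [pow_succ]

theorem finsetSum {ι : Type} (s : Finset ι) {g : ι → α → ℕ} (hg : ∀ i, TmFun (g i)) :
    TmFun fun a => ∑ i ∈ s, g i a := by
  classical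
  induction s using Finset.induction_on with
  | empty => exact (const 0).congr fun a => by simp
  | insert i s hi ih => exact ((hg i).add ih).congr fun a => by rw [Finset.sum_insert hi]

end TmFun

namespace TmRel

theorem congr (hp : TmRel p) (h : ∀ a, p a ↔ q a) : TmRel q :=
  (funext fun a => propext (h a) : p = q) ▸ hp

theorem const (b : Prop) : TmRel fun _ : α => b := by
  classical
  exact ⟨_, TmFun.const (if b then 1 else 0), fun a => by simp⟩

theorem lt (hf : TmFun f) (hg : TmFun g) : TmRel fun a => f a < g a :=
  ⟨_, hg.sub hf, fun a => by omega⟩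

theorem le (hf : TmFun f) (hg : TmFun g) : TmRel fun a => f a ≤ g a :=
  ⟨_, ((TmFun.const 1).add hg).sub hf, fun a => by omega⟩

theorem eq (hf : TmFun f) (hg : TmFun g) : TmRel fun a => f a = g a :=
  ⟨_, ((TmFun.const 1).sub (hf.sub hg)).sub (hg.sub hf), fun a => by omega⟩

theorem not (hp : TmRel p) : TmRel fun a => ¬ p a := by
  obtain ⟨f, hf, h⟩ := hp
  exact ⟨_, (TmFun.const 1).sub hf, fun a => by simp only [h]; omega⟩

theorem and (hp : TmRel p) (hq : TmRel q) : TmRel fun a => p a ∧ q a := by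
  obtain ⟨f, hf, h⟩ := hp
  obtain ⟨g, hg, h'⟩ := hq
  exact ⟨_, hf.mul hg, fun a => by simp only [h, h', mul_ne_zero_iff]⟩

theorem or (hp : TmRel p) (hq : TmRel q) : TmRel fun a => p a ∨ q a :=
  (hp.not.and hq.not).not.congr fun a => by tauto

theorem imp (hp : TmRel p) (hq : TmRel q) : TmRel fun a => p a → q a :=
  (hp.not.or hq).congr fun a => by tauto

theorem iff (hp : TmRel p) (hq : TmRel q) : TmRel fun a => p a ↔ q a :=
  ((hp.imp hq).and (hq.imp hp)).congr fun a => by tauto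

/-- A sum of natural numbers is nonzero exactly if some summand is. -/
theorem ex {p : α → ℕ → Prop} (hf : TmFun f) (hp : TmRel fun a : Ext α => p a.fst a.snd) :
    TmRel fun a => ∃ i < f a, p a i := by
  obtain ⟨g, hg, h⟩ := hp
  refine ⟨_, hf.sum (g := fun a i => g ⟨a, i⟩) hg, fun a => ?_⟩
  have h' : ∀ i, p a i ↔ g ⟨a, i⟩ ≠ 0 := fun i => h ⟨a, i⟩
  simp [h']

theorem all {p : α → ℕ → Prop} (hf : TmFun f) (hp : TmRel fun a : Ext α => p a.fst a.snd) :
    TmRel fun a => ∀ i < f a, p a i :=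
  (ex (p := fun a i => ¬ p a i) hf hp.not).not.congr fun a => by push Not; rfl

theorem finEx {n : ℕ} {p : Fin n → α → Prop} (hp : ∀ i, TmRel (p i)) :
    TmRel fun a => ∃ i, p i a := by
  choose g hg h using hp
  refine ⟨_, TmFun.finsetSum Finset.univ hg, fun a => ?_⟩
  simp [h]

theorem finAll {n : ℕ} {p : Fin n → α → Prop} (hp : ∀ i, TmRel (p i)) :
    TmRel fun a => ∀ i, p i a :=
  (finEx fun i => (hp i).not).not.congr fun a => by push Not; rfl

end TmRel

open Classical in
theorem TmFun.indicator (hp : TmRel p) : TmFun fun a => if p a then 1 else 0 := by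
  obtain ⟨f, hf, h⟩ := hp
  refine ((TmFun.const 1).sub ((TmFun.const 1).sub hf)).congr fun a => ?_
  split_ifs with ha <;> rw [h] at ha <;> omega

open Classical in
theorem TmFun.ite (hp : TmRel p) (hf : TmFun f) (hg : TmFun g) :
    TmFun fun a => if p a then f a else g a := by
  refine (((indicator hp).mul hf).add ((indicator hp.not).mul hg)).congr fun a => ?_
  by_cases h : p a <;> simp [h]

end closure

/-! ### Reductions that are given by terms -/

open Classical in
/-- The word of length `L` with the letter `1` at the positions in `bit`. -/
noncomputable def bitWord (L : ℕ) (bit : ℕ → Prop) : List (Fin 2) :=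
  (List.range L).map fun i => if bit i then 1 else 0

/-- The program that writes the values of `u` at `0, …, t - 1`, and then puts the value of `v` into
register `1`. -/
def outputProg (b : ℕ) (t u v : Tm) (m : ℕ → ℕ) (d : ℕ) : Prog :=
  .seq (t.compile b m d) (.seq (.assign (d + 1) (.const 0))
    (.seq (.loop (.sub (.reg d) (.reg (d + 1)))
        (.seq (u.compile b (push (d + 1) m) (d + 2))
          (.seq (.write (.reg (d + 2))) (.assign (d + 1) (.add (.reg (d + 1)) (.const 1))))))
      (.seq (v.compile b m d) (.assign 1 (.reg d)))))

/-- The bound `s` refers to the stored word and variables, so the program can be started on an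
intermediate instance. Register `1` is overwritten last because the terms may read the old parameter
there. -/
theorem run_outputProg (t u v : Tm) : ∃ c, ∀ (b : ℕ) (m : ℕ → ℕ) (d : ℕ) (w ρ : ℕ → ℕ) (s : ℕ)
    (σ : State), 2 ≤ s → (∀ i, w i ≤ s) → (∀ i, ρ i ≤ s) → (∀ i, m i < d) →
    (∀ i, σ.reg (m i) = ρ i) → σ.arr b = w → σ.out = [] →
    ∃ σ' τ, Run (outputProg b t u v m d) σ σ' τ ∧ τ ≤ s ^ c ∧
      σ'.out = (List.range (t.eval w ρ)).map (fun i => u.eval w (push i ρ)) ∧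
      σ'.reg 1 = v.eval w ρ := by
  obtain ⟨c₁, h₁⟩ := t.run_compile
  obtain ⟨c₁', e₁⟩ := t.eval_le
  obtain ⟨c₂, h₂⟩ := u.run_compile
  obtain ⟨c₃, h₃⟩ := v.run_compile
  set a := max (max c₁ c₁') c₃ + 1 with ha
  refine ⟨a * (c₂ + 4), fun b m d w ρ s σ hs hw hρ hm hσ hb ho => ?_⟩
  have hsa : s ≤ s ^ a := Nat.le_self_pow (by omega) s
  obtain ⟨σ₁, τ₁, r₁, ht₁, hd₁, k₁⟩ := h₁ b m d w ρ s σ hs hw hρ hm hσ hb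
  have hn : t.eval w ρ ≤ s ^ a :=
    (e₁ w ρ s hs hw hρ).trans (Nat.pow_le_pow_right (by omega) (by omega))
  have ht₁' : τ₁ ≤ s ^ a := ht₁.trans (Nat.pow_le_pow_right (by omega) (by omega))
  set n := t.eval w ρ with hn'
  set σ₂ : State := { σ₁ with reg := Function.update σ₁.reg (d + 1) 0 } with hσ₂
  have k₂ : Keeps d σ σ₂ := k₁.trans (Keeps.assign (by omega) _ _)
  obtain ⟨σ₄, τ₄, r₄, ht₄, k₄, ka₄, hl₄, ho₄, hi₄⟩ := run_loop_of_inv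
    (e := .sub (.reg d) (.reg (d + 1)))
    (p := .seq (u.compile b (push (d + 1) m) (d + 2))
          (.seq (.write (.reg (d + 2))) (.assign (d + 1) (.add (.reg (d + 1)) (.const 1)))))
    (n := n) (C := (s ^ a) ^ c₂ + 2)
    (inv := fun i σ' => (∀ r < d, σ'.reg r = σ.reg r) ∧ σ'.arr = σ.arr ∧ σ'.reg d = n ∧
      σ'.out = (List.range i).map (fun i => u.eval w (push i ρ)) ∧ σ'.reg (d + 1) = i)
    (by
      rintro i hi σ' ⟨k, ka, hl, hout, hc⟩
      refine ⟨by simp only [Expr.eval, hl, hc]; omega, ?_⟩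
      obtain ⟨σ₅, τ₅, r₅, ht₅, hd₅, k₅⟩ := h₂ b (push (d + 1) m) (d + 2) w (push i ρ) (s ^ a) σ'
        (hs.trans hsa) (fun j => (hw j).trans hsa)
        (push_le (hi.le.trans hn) fun j => (hρ j).trans hsa)
        (by
          rintro (_ | j)
          · exact Nat.lt_succ_self _
          · exact (hm j).trans (by omega))
        (by
          rintro (_ | j)
          · exact hc
          · exact (k _ (hm j)).trans (hσ j))
        ((congrFun ka b).trans hb)
      refine ⟨_, _, .seq r₅ (.seq (.write _ _) (.assign _ _ _)), by omega, fun r hr => ?_, ?_, ?_,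
        ?_, ?_⟩
      · simp only
        rw [Function.update_of_ne (by omega), k₅.1 r (by omega), k r hr]
      · simp [k₅.2.1, ka]
      · simp [k₅.1 d (by omega), hl]
      · simp [Expr.eval, k₅.2.2, hout, hd₅, List.range_succ]
      · simp [Expr.eval, k₅.1 (d + 1) (by omega), hc])
    (by
      rintro σ' ⟨_, _, hl, _, hc⟩
      simp [Expr.eval, hl, hc])
    (σ := σ₂) ⟨k₂.1, k₂.2.1, by simp [hσ₂, hd₁], by simp [hσ₂, k₁.2.2, ho], by simp [hσ₂]⟩
  obtain ⟨σ₆, τ₆, r₆, ht₆, hd₆, k₆⟩ := h₃ b m d w ρ s σ₄ hs hw hρ hm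
    (fun i => (k₄ _ (hm i)).trans (hσ i)) ((congrFun ka₄ b).trans hb)
  have ht₆' : τ₆ ≤ s ^ a := ht₆.trans (Nat.pow_le_pow_right (by omega) (by omega))
  refine ⟨_, _, .seq r₁ (.seq (.assign _ _ _) (.seq r₄ (.seq r₆ (.assign _ _ _)))), ?_, ?_, ?_⟩
  · have f1 : n * ((s ^ a) ^ c₂ + 2 + 1) ≤ s ^ a * ((s ^ a) ^ c₂ + 2 + 1) :=
      Nat.mul_le_mul_right _ hn
    have f2 : 1 ≤ (s ^ a) ^ c₂ := Nat.one_le_pow _ _ (by omega)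
    have f3 : 2 ≤ s ^ a := hs.trans hsa
    have f4 : s ^ a ≤ s ^ a * (s ^ a) ^ c₂ := Nat.le_mul_of_pos_right _ f2
    have f5 : 8 ≤ (s ^ a) ^ 3 := Nat.pow_le_pow_left f3 3
    have f6 : s ^ a * (s ^ a) ^ c₂ * 8 ≤ s ^ a * (s ^ a) ^ c₂ * (s ^ a) ^ 3 :=
      Nat.mul_le_mul_left _ f5
    have f7 : s ^ (a * (c₂ + 4)) = s ^ a * (s ^ a) ^ c₂ * (s ^ a) ^ 3 := by
      rw [pow_mul]; ring
    rw [f7]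
    have f8 : s ^ a * ((s ^ a) ^ c₂ + 2 + 1) = s ^ a * (s ^ a) ^ c₂ + 3 * s ^ a := by ring
    omega
  · simp [k₆.2.2, ho₄, hn']
  · simp [Expr.eval, hd₆]

/-- An fpt-reduction followed by a reduction that is given by terms. -/
theorem FptReducible.trans_terms {s s₁ : ℕ} {Q : ParamProblem s} {Q₁ : ParamProblem s₁}
    {Q₂ : ParamProblem 2} (h : FptReducible Q Q₁) {L : List (Fin s₁) × ℕ → ℕ}
    {bit : List (Fin s₁) × ℕ → ℕ → Prop} {K : ℕ → ℕ} (hL : TmFun L)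
    (hbit : TmRel fun a : Ext (List (Fin s₁) × ℕ) => bit a.fst a.snd)
    (hK : TmFun fun z : List (Fin s₁) × ℕ => K z.2) (hKm : Monotone K) (hKc : Computable K)
    (hQ : ∀ z, z ∈ Q₁ ↔ (bitWord (L z) (bit z), K z.2) ∈ Q₂) : FptReducible Q Q₂ := by
  classical
  obtain ⟨f, hf, ⟨g, hgc, hg⟩, p, h, c, hhc, hp⟩ := h
  refine ⟨fun z => (bitWord (L (f z)) (bit (f z)), K (f z).2), fun z => (hf z).trans (hQ _),
    ⟨fun k => K (g k), hKc.comp hgc, fun z => hKm (hg z)⟩, ?_⟩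
  obtain ⟨t, ht⟩ := hL
  obtain ⟨u, hu⟩ := TmFun.indicator hbit
  obtain ⟨v, hv⟩ := hK
  obtain ⟨e, he⟩ := run_outputProg t u v
  -- The 2 keeps `F` away from registers `0` and `1` of the initial state, even if `p` mentions
  -- neither.
  set F := p.fresh + 2 with hF
  have hpow : ∀ e : ℕ, Computable fun n : ℕ => n ^ e := by
    intro e
    induction e with
    | zero => exact (Computable.const 1).of_eq fun n => by simp
    | succ e ih => exact (Primrec.nat_mul.to_comp.comp ih Computable.id).of_eq fun n => rfl
  -- Variable `0` is the length of the intermediate word, found in register `F`; all other variables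
  -- are its parameter, in register `1`. The two summands of the time bound pay for the redirected
  -- run and for the output.
  refine ⟨.seq (p.redirect F) (outputProg F t u v (push F fun _ => 1) (F + 1)),
    fun k => 2 * h k + (h k + g k + s₁ + 2) ^ e, c + c * e, ?_, fun x k => ?_⟩
  · exact Primrec.nat_add.to_comp.comp
      (Primrec.nat_mul.to_comp.comp (Computable.const 2) hhc)
      ((hpow e).comp (Primrec.nat_add.to_comp.comp (Primrec.nat_add.to_comp.comp
        (Primrec.nat_add.to_comp.comp hhc hgc) (Computable.const s₁)) (Computable.const 2)))
  obtain ⟨σ, τ, r, ho, h1, hτ⟩ := hp x k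
  obtain ⟨σ', τ', r', hτ', red⟩ := r.redirect (F := F) (by omega)
    (redirected_initState (by omega) x k)
  set y := f (x, k) with hy
  have hlen : y.1.length ≤ τ := by
    have := r.length_out_le
    rw [ho] at this
    simpa [initState] using this
  -- The running time bounds the length of the intermediate word, `g k` its parameter and `s₁` its
  -- letters.
  set S := h k * (x.length + 1) ^ c + g k + s₁ + 2 with hS
  have hword : σ'.arr F = Ctx.word y := funext fun i => by
    rw [red.word, ho]
    rfl
  obtain ⟨σ'', τ'', r'', hτ'', ho'', h1''⟩ := he F (push F fun _ => 1) (F + 1) (Ctx.word y)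
    (Ctx.env y) S σ' (by omega)
    (fun i => by
      change (y.1.map Fin.val).getD i 0 ≤ S
      rcases lt_or_ge i (y.1.map Fin.val).length with hi | hi
      · rw [List.getD_eq_getElem _ _ hi, List.getElem_map]
        exact (Fin.is_lt _).le.trans (by omega)
      · rw [List.getD_eq_default _ _ hi]
        exact Nat.zero_le _)
    (push_le (by omega) fun i => (hg (x, k)).trans (by simp only; omega))
    (by
      rintro (_ | j)
      · exact Nat.lt_succ_self _
      · change 1 < F + 1
        omega)
    (by
      rintro (_ | j)
      · change σ'.reg F = y.1.length
        rw [red.length, ho, List.length_map]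
      · change σ'.reg 1 = y.2
        rw [red.reg 1 (by omega), h1])
    hword red.out
  refine ⟨σ'', τ' + τ'', .seq r' r'', ?_, ?_, ?_⟩
  · rw [ho'', ht]
    simp only [bitWord, List.map_map]
    refine List.map_congr_left fun i _ => ?_
    refine (hu ⟨y, i⟩).trans ?_
    simp only [Function.comp]
    split_ifs <;> rfl
  · rw [h1'', hv]
  · have hx : 1 ≤ (x.length + 1) ^ c := Nat.one_le_pow _ _ (by omega)
    have hS' : S ≤ (h k + g k + s₁ + 2) * (x.length + 1) ^ c := by
      have := Nat.mul_le_mul_left (g k + s₁ + 2) hx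
      have e1 : (h k + g k + s₁ + 2) * (x.length + 1) ^ c =
        h k * (x.length + 1) ^ c + (g k + s₁ + 2) * (x.length + 1) ^ c := by ring
      omega
    have h2 : τ'' ≤ (h k + g k + s₁ + 2) ^ e * (x.length + 1) ^ (c * e) := by
      refine hτ''.trans ((Nat.pow_le_pow_left hS' e).trans ?_)
      rw [mul_pow, pow_mul]
    have h3 : (x.length + 1) ^ c ≤ (x.length + 1) ^ (c + c * e) :=
      Nat.pow_le_pow_right (by omega) (by omega)
    have h4 : (x.length + 1) ^ (c * e) ≤ (x.length + 1) ^ (c + c * e) :=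
      Nat.pow_le_pow_right (by omega) (by omega)
    calc τ' + τ'' ≤ 2 * (h k * (x.length + 1) ^ c) +
          (h k + g k + s₁ + 2) ^ e * (x.length + 1) ^ (c * e) := by omega
      _ ≤ 2 * (h k * (x.length + 1) ^ (c + c * e)) +
          (h k + g k + s₁ + 2) ^ e * (x.length + 1) ^ (c + c * e) := by gcongr
      _ = _ := by ring

/-! ### From hitting sets to vertex deletion -/

/-- The oriented edges of the graph of a set system; `v % 5` is the kind of the vertex `v`. Every
element `u` has two adjacent vertices `5 * u` and `5 * u + 1`. A vertex `v` of kind `2` or `3`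
is a set, which is joined to both vertices of its elements. The vertices `4` and `9` are hubs, and
the other vertices of kind `4` are leaves. -/
def gadgetEdge (mem : ℕ → ℕ → Prop) (v w : ℕ) : Prop :=
  (v % 5 = 0 ∧ w % 5 = 1 ∧ v / 5 = w / 5) ∨
  ((v % 5 = 2 ∨ v % 5 = 3) ∧ w % 5 ≤ 1 ∧ mem v (w / 5)) ∨
  (v % 5 = 0 ∧ w = 4) ∨ (v % 5 = 1 ∧ w = 9) ∨ (v = 9 ∧ w = 4) ∨
  (v % 5 = 4 ∧ v ≠ 4 ∧ v ≠ 9 ∧ w = 4)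

/-- Adjacency in the graph of a set system. -/
def gadgetAdj (mem : ℕ → ℕ → Prop) (v w : ℕ) : Prop :=
  gadgetEdge mem v w ∨ gadgetEdge mem w v

theorem gadgetAdj_symm {mem : ℕ → ℕ → Prop} {v w : ℕ} (h : gadgetAdj mem v w) :
    gadgetAdj mem w v := h.symm

theorem gadgetAdj_ne {mem : ℕ → ℕ → Prop} {v w : ℕ} (h : gadgetAdj mem v w) : v ≠ w := by
  unfold gadgetAdj gadgetEdge at h
  omega

/-- The graph on `{0, …, N - 1} ∖ S` with adjacency `adj` satisfies `phiAEA`. -/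
def SatAEA (adj : ℕ → ℕ → Prop) (N : ℕ) (S : Finset ℕ) : Prop :=
  ∀ x < N, x ∉ S → ∃ y < N, y ∉ S ∧ ∀ z < N, z ∉ S →
    (adj x y ∧ (adj y z → ¬ adj x z)) ∨ x = z

/-- It suffices to delete the vertex of kind `0` of each element of `H`. A surviving element vertex
uses its hub, the hubs use each other, and leaves use `4`. A set with an element `u` in `H` uses `5
* u + 1`, since the only common neighbour `5 * u` is gone. `2 ≤ B` makes room for the hub `9`. -/
theorem satAEA_of_hitting {mem : ℕ → ℕ → Prop} {B : ℕ} (hB : 2 ≤ B) {H : Finset ℕ}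
    (hHB : ∀ u ∈ H, u < B)
    (hH : ∀ v < 5 * B, v % 5 = 2 ∨ v % 5 = 3 → ∃ u ∈ H, mem v u) :
    SatAEA (gadgetAdj mem) (5 * B) (H.image (5 * ·)) := by
  have hS : ∀ v, v % 5 ≠ 0 → v ∉ H.image (5 * ·) := by
    intro v hv h
    obtain ⟨u, -, hu⟩ := Finset.mem_image.1 h
    omega
  intro x hx hxS
  have h5 : x % 5 = 0 ∨ x % 5 = 1 ∨ (x % 5 = 2 ∨ x % 5 = 3) ∨ x % 5 = 4 := by omega
  rcases h5 with h | h | h | h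
  · refine ⟨4, by omega, hS _ (by omega), fun z _ _ => .inl ⟨?_, fun h1 h2 => ?_⟩⟩
    · unfold gadgetAdj gadgetEdge; omega
    · unfold gadgetAdj gadgetEdge at h1 h2; omega
  · refine ⟨9, by omega, hS _ (by omega), fun z _ _ => .inl ⟨?_, fun h1 h2 => ?_⟩⟩
    · unfold gadgetAdj gadgetEdge; omega
    · unfold gadgetAdj gadgetEdge at h1 h2; omega
  · obtain ⟨u, hu, hm⟩ := hH x hx h
    have := hHB u hu
    refine ⟨5 * u + 1, by omega, hS _ (by omega), fun z _ hz => .inl ⟨?_, fun h1 h2 => hz ?_⟩⟩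
    · exact .inl (.inr (.inl ⟨h, by omega, by rwa [show (5 * u + 1) / 5 = u by omega]⟩))
    · refine Finset.mem_image.2 ⟨u, hu, ?_⟩
      unfold gadgetAdj gadgetEdge at h1 h2
      omega
  · by_cases h4 : x = 4
    · refine ⟨9, by omega, hS _ (by omega), fun z _ _ => .inl ⟨?_, fun h1 h2 => ?_⟩⟩
      · unfold gadgetAdj gadgetEdge; omega
      · rw [h4] at h2; clear h4
        unfold gadgetAdj gadgetEdge at h1 h2; omega
    · refine ⟨4, by omega, hS _ (by omega), fun z _ _ => .inl ⟨?_, fun h1 h2 => ?_⟩⟩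
      · unfold gadgetAdj gadgetEdge; omega
      · have hz : z = 4 ∨ (x = 9 ∧ z % 5 = 1) := by
          clear h1
          unfold gadgetAdj gadgetEdge at h2
          omega
        unfold gadgetAdj gadgetEdge at h1
        omega

/-- If every set of a set system occurs often enough, then the hitting sets of the system correspond
to the solutions of the vertex deletion problem on its graph. -/
theorem exists_satAEA_iff {mem : ℕ → ℕ → Prop} {B K : ℕ} (hB : 2 ≤ B)
    (hcopies : ∀ v < 5 * B, v % 5 = 2 ∨ v % 5 = 3 → ∃ C : Finset ℕ, K + 2 ≤ C.card ∧
      ∀ v' ∈ C, v' < 5 * B ∧ (v' % 5 = 2 ∨ v' % 5 = 3) ∧ ∀ u, mem v' u → mem v u) :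
    (∃ S : Finset ℕ, S.card ≤ K ∧ SatAEA (gadgetAdj mem) (5 * B) S) ↔
      ∃ H : Finset ℕ, H.card ≤ K ∧ (∀ u ∈ H, u < B) ∧
        ∀ v < 5 * B, v % 5 = 2 ∨ v % 5 = 3 → ∃ u ∈ H, mem v u := by
  constructor
  · rintro ⟨S, hSK, hS⟩
    -- Deleted set vertices and hubs contribute superfluous elements, which are harmless in a
    -- hitting set.
    refine ⟨(S.filter fun v => v < 5 * B).image (· / 5),
      Finset.card_image_le.trans ((Finset.card_filter_le _ _).trans hSK), ?_, ?_⟩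
    · intro u hu
      obtain ⟨v, hv, rfl⟩ := Finset.mem_image.1 hu
      have := (Finset.mem_filter.1 hv).2
      omega
    · intro v hv hk
      obtain ⟨C, hC, hC'⟩ := hcopies v hv hk
      -- Two survivors are needed: the formula guarantees `x ∼ y` only in the presence of some `z ≠
      -- x`. Hence `K + 2` copies rather than `K + 1`.
      have h2 : 1 < (C \ S).card := by
        have := Finset.le_card_sdiff S C
        omega
      obtain ⟨x, hx, x', hx', hne⟩ := Finset.one_lt_card.1 h2
      rw [Finset.mem_sdiff] at hx hx'
      obtain ⟨hxB, hxk, hxm⟩ := hC' x hx.1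
      obtain ⟨y, hyB, hyS, hy⟩ := hS x hxB hx.2
      have hxy : gadgetAdj mem x y :=
        ((hy x' (hC' x' hx'.1).1 hx'.2).resolve_right hne).1
      have hy1 : y % 5 ≤ 1 := by
        unfold gadgetAdj gadgetEdge at hxy
        omega
      have hm : mem x (y / 5) := by
        rcases hxy with h | h <;> unfold gadgetEdge at h
        · rcases h with h | h | h
          · omega
          · exact h.2.2
          · omega
        · omega
      refine ⟨y / 5, ?_, hxm _ hm⟩
      -- `z` is the other end of the edge of the element. If it survived, it would form a triangle
      -- with `x` and `y`.
      set z := if y % 5 = 0 then y + 1 else y - 1 with hz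
      have hz' : z < 5 * B ∧ z / 5 = y / 5 ∧ z % 5 ≤ 1 ∧ z ≠ x := by
        split_ifs at hz <;> omega
      by_cases hzS : z ∈ S
      · exact Finset.mem_image.2 ⟨z, Finset.mem_filter.2 ⟨hzS, hz'.1⟩, hz'.2.1⟩
      · have h3 := ((hy z hz'.1 hzS).resolve_right hz'.2.2.2.symm).2
        refine absurd (.inl (.inr (.inl ⟨hxk, hz'.2.2.1, by rwa [hz'.2.1]⟩))) (h3 ?_)
        split_ifs at hz with h0
        · exact .inl (.inl (by omega))
        · exact .inr (.inl (by omega))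
  · rintro ⟨H, hHK, hHB, hH⟩
    exact ⟨_, Finset.card_image_le.trans hHK, satAEA_of_hitting hB hHB hH⟩

/-! ### Encodings of structures -/

/-- The position of the table of the `i`-th symbol, for tables of lengths `ℓ`. -/
def tableOffset {m : ℕ} (ℓ : Fin m → ℕ) (i : Fin m) : ℕ :=
  ∑ j, if j < i then ℓ j else 0

theorem tableOffset_zero {m : ℕ} (ℓ : Fin (m + 1) → ℕ) : tableOffset ℓ 0 = 0 := by
  simp [tableOffset]

theorem tableOffset_succ {m : ℕ} (ℓ : Fin (m + 1) → ℕ) (i : Fin m) :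
    tableOffset ℓ i.succ = ℓ 0 + tableOffset (fun j => ℓ j.succ) i := by
  simp [tableOffset, Fin.sum_univ_succ]

theorem getD_flatMap_finRange {β : Type} (d : β) {m : ℕ} (y : Fin m → List β) (i : Fin m) {j : ℕ}
    (hj : j < (y i).length) :
    ((List.finRange m).flatMap y).getD (tableOffset (fun i => (y i).length) i + j) d =
      (y i).getD j d := by
  induction m with
  | zero => exact i.elim0
  | succ m ih =>
    rw [List.finRange_succ, List.flatMap_cons, List.flatMap_map]
    cases i using Fin.cases with
    | zero => rw [tableOffset_zero, Nat.zero_add, List.getD_append _ _ _ _ hj]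
    | succ i =>
      rw [tableOffset_succ, List.getD_append_right _ _ _ _ (by omega), Nat.add_assoc,
        Nat.add_sub_cancel_left]
      exact ih (fun i => y i.succ) i hj

/-- Used to show that every word with the right prefix and length is an encoding: the pieces cut at
the table offsets reassemble the word. -/
theorem eq_flatMap_finRange {β : Type} (d : β) {m : ℕ} (ℓ : Fin m → ℕ) (y : List β)
    (hy : y.length = ∑ i, ℓ i) :
    (List.finRange m).flatMap (fun i => List.ofFn fun j : Fin (ℓ i) =>
      y.getD (tableOffset ℓ i + j) d) = y := by
  induction m generalizing y with
  | zero =>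
    rw [Fin.sum_univ_zero, List.length_eq_zero_iff] at hy
    simp [hy]
  | succ m ih =>
    rw [Fin.sum_univ_succ] at hy
    rw [List.finRange_succ, List.flatMap_cons, List.flatMap_map]
    conv_rhs => rw [← List.take_append_drop (ℓ 0) y]
    congr 1
    · refine List.ext_getElem (by simp; omega) fun n h₁ h₂ => ?_
      simp only [List.length_ofFn] at h₁
      simp only [List.getElem_ofFn, List.getElem_take, tableOffset_zero, Nat.zero_add]
      rw [List.getD_eq_getElem _ _ (by omega)]
    · refine Eq.trans ?_ (ih (fun i => ℓ i.succ) (y.drop (ℓ 0)) (by simp; omega))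
      congr 1
      funext i
      simp only [tableOffset_succ, List.getD_eq_getElem?_getD, List.getElem?_drop, Nat.add_assoc]

/-- The lengths of the tables of a structure. -/
def tableLength (τ : Vocab) (n : ℕ) (i : Fin τ.num) : ℕ := n ^ τ.arity i

theorem FinStruct.length_encode {τ : Vocab} (A : FinStruct τ) :
    A.encode.length = A.size + 1 + ∑ i, tableLength τ A.size i := by
  simp [FinStruct.encode, tableLength, List.length_flatMap, Fin.sum_univ_def, Nat.add_assoc,
    Nat.add_comm]

theorem FinStruct.getD_encode_of_lt {τ : Vocab} (A : FinStruct τ) {i : ℕ} (hi : i < A.size) :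
    A.encode.getD i 0 = 1 := by
  rw [FinStruct.encode, List.getD_append _ _ _ _ (by simpa using hi),
    List.getD_eq_getElem _ _ (by simpa using hi), List.getElem_replicate]

theorem FinStruct.getD_encode_size {τ : Vocab} (A : FinStruct τ) :
    A.encode.getD A.size 0 = 0 := by
  rw [FinStruct.encode, List.getD_append_right _ _ _ _ (by simp)]
  simp

theorem FinStruct.getD_encode {τ : Vocab} (A : FinStruct τ) (i : Fin τ.num)
    (a : Fin (τ.arity i) → Fin A.size) :
    A.encode.getD (A.size + 1 + (tableOffset (tableLength τ A.size) i + finFunctionFinEquiv a)) 0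
      = if A.rel i a then 1 else 0 := by
  rw [FinStruct.encode, List.getD_append_right _ _ _ _ (by simp; omega), List.length_replicate,
    show A.size + 1 + (tableOffset (tableLength τ A.size) i + finFunctionFinEquiv a) - A.size =
      (tableOffset (tableLength τ A.size) i + finFunctionFinEquiv a) + 1 by omega,
    List.getD_cons_succ]
  have h := getD_flatMap_finRange (0 : Fin 2) (fun i : Fin τ.num =>
    List.ofFn fun j : Fin (A.size ^ τ.arity i) =>
      if A.rel i (finFunctionFinEquiv.symm j) then (1 : Fin 2) else 0) i
      (j := finFunctionFinEquiv a) (by rw [List.length_ofFn]; exact Fin.is_lt _)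
  simp only [List.length_ofFn] at h
  refine h.trans ?_
  rw [List.getD_eq_getElem _ _ (by rw [List.length_ofFn]; exact Fin.is_lt _), List.getElem_ofFn]
  simp only [Fin.eta, Equiv.symm_apply_apply]

/-- The prefix `1ⁿ0` fixes the size, after which every table entry has a known position. Thus the
structure quantified over in the problems is determined by the instance. -/
theorem FinStruct.encode_injective (τ : Vocab) :
    Function.Injective (FinStruct.encode : FinStruct τ → List (Fin 2)) := by
  intro A A' h
  have hs : A.size = A'.size := by
    rcases lt_trichotomy A.size A'.size with hlt | heq | hlt
    · have := A'.getD_encode_of_lt hlt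
      rw [← h, A.getD_encode_size] at this
      exact absurd this (by decide)
    · exact heq
    · have := A.getD_encode_of_lt hlt
      rw [h, A'.getD_encode_size] at this
      exact absurd this (by decide)
  obtain ⟨n, hn, R⟩ := A
  obtain ⟨n', hn', R'⟩ := A'
  obtain rfl : n = n' := hs
  congr 1
  funext i a
  have h1 := FinStruct.getD_encode ⟨n, hn, R⟩ i a
  have h2 := FinStruct.getD_encode ⟨n, hn', R'⟩ i a
  rw [h] at h1
  have h3 := h1.symm.trans h2
  simp only at h3
  cases hR : R i a <;> cases hR' : R' i a <;> simp_all

/-- The words that encode structures, and the structures that they encode. -/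
theorem exists_encode_eq_iff {τ : Vocab} (y : List (Fin 2)) :
    (∃ A : FinStruct τ, y = A.encode) ↔ ∃ n, 0 < n ∧ (∀ i < n, y.getD i 0 = 1) ∧
      y.getD n 0 = 0 ∧ y.length = n + 1 + ∑ i, tableLength τ n i := by
  constructor
  · rintro ⟨A, rfl⟩
    exact ⟨A.size, A.size_pos, fun i hi => A.getD_encode_of_lt hi, A.getD_encode_size,
      A.length_encode⟩
  · rintro ⟨n, hn, h1, h0, hl⟩
    refine ⟨⟨n, hn, fun i a => y.getD (n + 1 + (tableOffset (tableLength τ n) i +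
      finFunctionFinEquiv a)) 0 = 1⟩, ?_⟩
    have hd := eq_flatMap_finRange (0 : Fin 2) (tableLength τ n) (y.drop (n + 1)) (by simp; omega)
    rw [FinStruct.encode]
    conv_lhs => rw [← List.take_append_drop n y]
    congr 1
    · refine List.ext_getElem (by simp; omega) fun i h₁ h₂ => ?_
      simp only [List.length_replicate] at h₂
      rw [List.getElem_take, List.getElem_replicate, ← h1 i h₂, List.getD_eq_getElem]
    · rw [List.drop_eq_getElem_cons (by omega), ← List.getD_eq_getElem _ 0, h0, ← hd]
      congr 2
      funext i
      congr 1
      funext j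
      have key : ∀ b c : Fin 2, c = b → b = if decide (c = 1) then 1 else 0 := by decide
      refine key _ _ ?_
      simp only [List.getD_eq_getElem?_getD, List.getElem?_drop]
      exact congrArg (fun p : Fin (n ^ τ.arity i) =>
        y[n + 1 + (tableOffset (tableLength τ n) i + (p : ℕ))]?.getD 0)
        (Equiv.apply_symm_apply finFunctionFinEquiv j)

/-! ### Graphs -/

theorem realize_adj (A : FinStruct graphVocab) {M : Type} (ι : M → Fin A.size) {n : ℕ}
    (i j : Fin n) (v : Empty → M) (xs : Fin n → M) :
    letI := A.induced ι
    (adj (&i) (&j)).Realize v xs ↔ A.rel (0 : Fin 1) ![ι (xs i), ι (xs j)] = true := by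
  let _ := A.induced ι
  refine FirstOrder.Language.BoundedFormula.realize_rel₂.trans ?_
  change A.rel _ _ = true ↔ _
  refine Eq.congr (congrArg _ (funext fun l => ?_)) rfl
  fin_cases l <;> rfl

theorem minusModels_phiAEA (A : FinStruct graphVocab) (S : Finset (Fin A.size)) :
    A.MinusModels S phiAEA ↔ ∀ x ∉ S, ∃ y ∉ S, ∀ z ∉ S,
      (A.rel (0 : Fin 1) ![x, y] = true ∧ (A.rel (0 : Fin 1) ![y, z] = true →
        ¬ A.rel (0 : Fin 1) ![x, z] = true)) ∨ x = z := by
  let _ := A.induced (Subtype.val : {v // v ∉ S} → Fin A.size)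
  have h : A.MinusModels S phiAEA ↔ ∀ x : {v // v ∉ S}, ∃ y : {v // v ∉ S},
      ∀ z : {v // v ∉ S}, (A.rel (0 : Fin 1) ![x.1, y.1] = true ∧
        (A.rel (0 : Fin 1) ![y.1, z.1] = true → ¬ A.rel (0 : Fin 1) ![x.1, z.1] = true)) ∨
        x = z := by
    simp only [FinStruct.MinusModels, phiAEA, FirstOrder.Language.Sentence.Realize,
      FirstOrder.Language.Formula.Realize, FirstOrder.Language.BoundedFormula.realize_all,
      FirstOrder.Language.BoundedFormula.realize_ex, FirstOrder.Language.BoundedFormula.realize_sup,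
      FirstOrder.Language.BoundedFormula.realize_inf, FirstOrder.Language.BoundedFormula.realize_imp,
      FirstOrder.Language.BoundedFormula.realize_not, realize_adj,
      FirstOrder.Language.BoundedFormula.realize_bdEqual]
    rfl
  rw [h]
  simp only [Subtype.forall, Subtype.exists, Subtype.mk.injEq, exists_prop]

theorem models_phiBasic_of {A : FinStruct graphVocab}
    (h : ∀ x y, A.rel (0 : Fin 1) ![x, y] = true → A.rel (0 : Fin 1) ![y, x] = true ∧ x ≠ y) :
    A.Models phiBasic := by
  let _ := A.induced id
  simp only [FinStruct.Models, phiBasic, FirstOrder.Language.Sentence.Realize,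
    FirstOrder.Language.Formula.Realize, FirstOrder.Language.BoundedFormula.realize_all,
    FirstOrder.Language.BoundedFormula.realize_inf, FirstOrder.Language.BoundedFormula.realize_imp,
    FirstOrder.Language.BoundedFormula.realize_not, realize_adj,
    FirstOrder.Language.BoundedFormula.realize_bdEqual]
  exact fun x y => h x y

theorem models_phiUndirected_of {A : FinStruct graphVocab}
    (h : ∀ x y, A.rel (0 : Fin 1) ![x, y] = true → A.rel (0 : Fin 1) ![y, x] = true) :
    A.Models phiUndirected := by
  let _ := A.induced id
  simp only [FinStruct.Models, phiUndirected, FirstOrder.Language.Sentence.Realize,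
    FirstOrder.Language.Formula.Realize, FirstOrder.Language.BoundedFormula.realize_all,
    FirstOrder.Language.BoundedFormula.realize_imp, realize_adj]
  exact fun x y => h x y

theorem adj_isAtomic {n : ℕ} (t₁ t₂ : graphVocab.lang.Term (Empty ⊕ Fin n)) :
    (adj t₁ t₂).IsAtomic := FirstOrder.Language.BoundedFormula.IsAtomic.rel _ _

theorem phiAEA_hasPattern : HasPattern [Quant.a, Quant.e, Quant.a] phiAEA := by
  refine .all (.ex (.all (.qf ?_)))
  have h : ∀ i j : Fin 3, (adj (&i) (&j)).IsQF := fun i j => (adj_isAtomic _ _).isQF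
  exact ((h 0 1).inf ((h 1 2).imp (h 0 2).not)).sup
    (FirstOrder.Language.BoundedFormula.IsAtomic.equal _ _).isQF

open Classical in
/-- The graph on `{0, …, N - 1}` with adjacency `E`. -/
noncomputable def graphOf (N : ℕ) (hN : 0 < N) (E : ℕ → ℕ → Prop) : FinStruct graphVocab where
  size := N
  size_pos := hN
  rel := fun _ v => decide (E (v (0 : Fin 2)) (v (1 : Fin 2)))

/-- The positions of the letter `1` in the encoding of a graph. -/
def graphBit (N : ℕ) (E : ℕ → ℕ → Prop) (p : ℕ) : Prop :=
  p < N ∨ (N < p ∧ E ((p - (N + 1)) % N) ((p - (N + 1)) / N % N))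

theorem encode_graphOf (N : ℕ) (hN : 0 < N) (E : ℕ → ℕ → Prop) :
    (graphOf N hN E).encode = bitWord (N + 1 + N ^ 2) (graphBit N E) := by
  classical
  have hl : (graphOf N hN E).encode.length = N + 1 + N ^ 2 := by
    rw [FinStruct.length_encode]
    congr 1
  refine List.ext_getElem (by simp [hl, bitWord]) fun p h₁ h₂ => ?_
  rw [← List.getD_eq_getElem _ 0]
  simp only [bitWord, List.getElem_map, List.getElem_range]
  rcases lt_trichotomy p N with h | h | h
  · rw [FinStruct.getD_encode_of_lt _ h, if_pos (.inl h)]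
  · subst h
    rw [if_neg]
    · exact FinStruct.getD_encode_size (graphOf p hN E)
    rintro (h | h) <;> omega
  · obtain ⟨j, rfl⟩ : ∃ j, p = N + 1 + j := ⟨p - (N + 1), by omega⟩
    have hj : j < N ^ 2 := by omega
    have hg := (graphOf N hN E).getD_encode (0 : Fin 1)
      (finFunctionFinEquiv.symm (⟨j, hj⟩ : Fin (N ^ 2)))
    have h0 : tableOffset (tableLength graphVocab (graphOf N hN E).size) (0 : Fin 1) = 0 :=
      tableOffset_zero _
    have he : ((finFunctionFinEquiv (finFunctionFinEquiv.symm (⟨j, hj⟩ : Fin (N ^ 2)))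
        : Fin (N ^ 2)) : ℕ) = j := by
      rw [Equiv.apply_symm_apply]
    rw [h0] at hg
    have hg' := (congrArg (fun q => (graphOf N hN E).encode.getD q 0)
      (congrArg (N + 1 + ·) ((Nat.zero_add j).symm.trans (congrArg (0 + ·) he.symm)))).trans hg
    refine Eq.trans hg' ?_
    -- The base-`N` digits of `j` are the two vertices, the least significant one first.
    have hb : graphBit N E (N + 1 + j) ↔ E (j / N ^ 0 % N) (j / N ^ 1 % N) := by
      simp [graphBit, show ¬ N + 1 + j < N by omega, show N < N + 1 + j by omega]
    simp only [hb, graphOf, decide_eq_true_eq]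
    rfl

/-- Membership of a graph in the vertex deletion problem. -/
theorem graphOf_mem_vdOn_iff {K : FinStruct graphVocab → Prop} {N : ℕ} (hN : 0 < N)
    {E : ℕ → ℕ → Prop} (hK : K (graphOf N hN E)) (k : ℕ) :
    (bitWord (N + 1 + N ^ 2) (graphBit N E), k) ∈ vdOn K phiAEA ↔
      ∃ S : Finset ℕ, S.card ≤ k ∧ SatAEA E N S := by
  rw [← encode_graphOf N hN E]
  have hsat : ∀ S : Finset (Fin N), (graphOf N hN E).MinusModels S phiAEA ↔
      SatAEA E N (S.map Fin.valEmbedding) := by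
    intro S
    refine (minusModels_phiAEA (graphOf N hN E) S).trans ?_
    have hm : ∀ x : Fin N, (x : ℕ) ∈ S.map Fin.valEmbedding ↔ x ∈ S := fun x =>
      Finset.mem_map' Fin.valEmbedding
    simp only [graphOf, decide_eq_true_eq]
    constructor
    · intro h x hx hxS
      obtain ⟨y, hy, hyz⟩ := h ⟨x, hx⟩ ((hm ⟨x, hx⟩).not.1 hxS)
      refine ⟨y, y.2, (hm y).not.2 hy, fun z hz hzS => ?_⟩
      exact (hyz ⟨z, hz⟩ ((hm ⟨z, hz⟩).not.1 hzS)).imp id (congrArg Fin.val)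
    · intro h x hxS
      obtain ⟨y, hyN, hy, hyz⟩ := h x x.2 ((hm x).not.2 hxS)
      refine ⟨⟨y, hyN⟩, (hm ⟨y, hyN⟩).not.1 hy, fun z hzS => ?_⟩
      exact (hyz z z.2 ((hm z).not.2 hzS)).imp id Fin.ext
  constructor
  · rintro ⟨A, -, hA, S, hS, hsol⟩
    obtain rfl := FinStruct.encode_injective _ hA
    exact ⟨_, (Finset.card_map _).trans_le hS, (hsat S).1 hsol⟩
  · rintro ⟨S, hS, hsol⟩
    refine ⟨_, hK, rfl, Finset.univ.filter fun x : Fin N => (x : ℕ) ∈ S, ?_, (hsat _).2 ?_⟩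
    · refine le_trans ?_ hS
      refine Finset.card_le_card_of_injOn Fin.val (fun x hx => ?_) Fin.val_injective.injOn
      exact (Finset.mem_filter.1 hx).2
    · have hm : ∀ x < N, x ∈ (Finset.univ.filter fun x : Fin N => (x : ℕ) ∈ S).map
          Fin.valEmbedding ↔ x ∈ S := by
        intro x hx
        simp only [Finset.mem_map, Finset.mem_filter, Finset.mem_univ, true_and,
          Fin.valEmbedding_apply]
        exact ⟨by rintro ⟨y, hy, rfl⟩; exact hy, fun h => ⟨⟨x, hx⟩, h, rfl⟩⟩
      intro x hx hxS
      obtain ⟨y, hy, hyS, hyz⟩ := hsol x hx ((hm x hx).not.1 hxS)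
      exact ⟨y, hy, (hm y hy).not.2 hyS, fun z hz hzS => hyz z hz ((hm z hz).not.1 hzS)⟩

/-- No structure is encoded by the empty word, which therefore serves as the no-instance for
malformed inputs. -/
theorem bitWord_zero_notMem_vdOn {τ : Vocab} {K : FinStruct τ → Prop} {φ : τ.lang.Sentence}
    (bit : ℕ → Prop) (k : ℕ) : (bitWord 0 bit, k) ∉ vdOn K φ := by
  rintro ⟨A, -, hA, -⟩
  have := A.length_encode
  rw [← hA] at this
  simp only [bitWord, List.range_zero, List.map_nil, List.length_nil] at this
  omega

/-! ### Chains and hitting sets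

A number `u` below `((k + 2) * (T + 2)) ^ Q` codes `Q` pairs of an index below `k + 2` and a value
below `T + 2`. -/

/-- The index of the `j`-th pair of `u`. -/
def pairIdx (k T u j : ℕ) : ℕ :=
  u / ((k + 2) * (T + 2)) ^ j % ((k + 2) * (T + 2)) / (T + 2)

/-- The value of the `j`-th pair of `u`. -/
def pairVal (k T u j : ℕ) : ℕ :=
  u / ((k + 2) * (T + 2)) ^ j % ((k + 2) * (T + 2)) % (T + 2)

theorem pairIdx_lt (k T u j : ℕ) : pairIdx k T u j < k + 2 :=
  Nat.div_lt_of_lt_mul (by rw [Nat.mul_comm (T + 2)]; exact Nat.mod_lt _ (by positivity))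

theorem pairVal_lt (k T u j : ℕ) : pairVal k T u j < T + 2 := Nat.mod_lt _ (by omega)

theorem exists_digits {D Q : ℕ} (g : Fin Q → Fin D) :
    ∃ u < D ^ Q, ∀ j : Fin Q, u / D ^ (j : ℕ) % D = g j := by
  refine ⟨finFunctionFinEquiv g, Fin.is_lt _, fun j => ?_⟩
  exact congrArg Fin.val (congrFun (finFunctionFinEquiv.symm_apply_apply g) j)

/-- A pair is packed into the single digit `(T + 2) * I + v` to the base `(k + 2) * (T + 2)`. -/
theorem exists_pairs {Q k T : ℕ} (I v : Fin Q → ℕ) (hI : ∀ j, I j < k + 2)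
    (hv : ∀ j, v j < T + 2) : ∃ u < ((k + 2) * (T + 2)) ^ Q,
      ∀ j : Fin Q, pairIdx k T u j = I j ∧ pairVal k T u j = v j := by
  obtain ⟨u, hu, h⟩ := exists_digits (D := (k + 2) * (T + 2)) (Q := Q)
    fun j => ⟨(T + 2) * I j + v j, by
      have h1 := Nat.mul_le_mul_left (T + 2) (Nat.succ_le_of_lt (hI j))
      have h2 := hv j
      rw [Nat.mul_succ] at h1
      rw [Nat.mul_comm (k + 2)]
      omega⟩
  refine ⟨u, hu, fun j => ?_⟩
  unfold pairIdx pairVal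
  rw [h j]
  constructor
  · change ((T + 2) * I j + v j) / (T + 2) = I j
    rw [Nat.mul_add_div (by omega), Nat.div_eq_of_lt (hv j), Nat.add_zero]
  · change ((T + 2) * I j + v j) % (T + 2) = v j
    rw [Nat.mul_add_mod, Nat.mod_eq_of_lt (hv j)]

/-- The pairs of `u` and those of `u'` are in the same order by index as by value. -/
def Compatible (Q k T u u' : ℕ) : Prop :=
  ∀ j j' : Fin Q, (pairIdx k T u j < pairIdx k T u' j' ↔ pairVal k T u j < pairVal k T u' j') ∧
    (pairIdx k T u' j' < pairIdx k T u j ↔ pairVal k T u' j' < pairVal k T u j)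

/-- The pairs of `u` and of `u'` have the same indices. -/
def SameIdx (Q k T u u' : ℕ) : Prop :=
  ∀ j : Fin Q, pairIdx k T u j = pairIdx k T u' j

/-- The set of the set system that requires that `e` is not selected, or else the selected code with
the indices of `f` is compatible with `e`. -/
def ChainSet (Q k T e f u : ℕ) : Prop :=
  (SameIdx Q k T u f ∧ Compatible Q k T u e) ∨ (SameIdx Q k T u e ∧ u ≠ e)

/-- `s 0 < ⋯ < s (k + 1)`, with values below `T + 2`. -/
structure IsChainSeq (k T : ℕ) (s : ℕ → ℕ) : Prop where
  lt : ∀ i < k + 2, s i < T + 2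
  mono : ∀ i < k + 2, ∀ j < k + 2, i < j → s i < s j

theorem IsChainSeq.lt_iff {k T : ℕ} {s : ℕ → ℕ} (h : IsChainSeq k T s) {i j : ℕ} (hi : i < k + 2)
    (hj : j < k + 2) : i < j ↔ s i < s j := by
  refine ⟨h.mono i hi j hj, fun hlt => ?_⟩
  by_contra hij
  rcases Nat.eq_or_lt_of_le (not_lt.1 hij) with rfl | h'
  · omega
  · have := h.mono j hj i hi h'
    omega

/-- The values of the pairs of `u` are given by `s`. -/
def Agrees (Q k T : ℕ) (s : ℕ → ℕ) (u : ℕ) : Prop :=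
  ∀ j : Fin Q, pairVal k T u j = s (pairIdx k T u j)

theorem IsChainSeq.exists_agrees {Q k T : ℕ} {s : ℕ → ℕ} (h : IsChainSeq k T s) (I : Fin Q → ℕ)
    (hI : ∀ j, I j < k + 2) : ∃ u < ((k + 2) * (T + 2)) ^ Q, Agrees Q k T s u ∧
      ∀ j : Fin Q, pairIdx k T u j = I j := by
  obtain ⟨u, hu, h'⟩ := exists_pairs I (fun j => s (I j)) hI fun j => h.lt _ (hI j)
  exact ⟨u, hu, fun j => by rw [(h' j).1, (h' j).2], fun j => (h' j).1⟩

/-- A chain gives a hitting set. -/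
theorem IsChainSeq.exists_hitting {k T : ℕ} {s : ℕ → ℕ} (h : IsChainSeq k T s) (Q : ℕ) :
    ∃ H : Finset ℕ, H.card ≤ (k + 2) ^ Q ∧ (∀ u ∈ H, u < ((k + 2) * (T + 2)) ^ Q) ∧
      (∀ e f, ∃ u ∈ H, ChainSet Q k T e f u) ∧
      ∀ I : Fin Q → ℕ, (∀ j, I j < k + 2) → ∃ u ∈ H, Agrees Q k T s u ∧
        ∀ j : Fin Q, pairIdx k T u j = I j := by
  choose c hcE hc hcI using fun I : Fin Q → Fin (k + 2) =>
    h.exists_agrees (fun j => (I j : ℕ)) fun j => (I j).2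
  refine ⟨Finset.univ.image c, Finset.card_image_le.trans (by simp), ?_, ?_, ?_⟩
  · intro u hu
    obtain ⟨I, -, rfl⟩ := Finset.mem_image.1 hu
    exact hcE I
  · intro e f
    set I : Fin Q → Fin (k + 2) := fun j => ⟨pairIdx k T e j, pairIdx_lt _ _ _ _⟩
    set J : Fin Q → Fin (k + 2) := fun j => ⟨pairIdx k T f j, pairIdx_lt _ _ _ _⟩
    -- If `e` is selected, the code selected for the indices of `f` is compatible with it; otherwise
    -- the code selected for the indices of `e` differs from `e`.
    by_cases hI : c I = e
    · refine ⟨c J, Finset.mem_image_of_mem _ (Finset.mem_univ _), .inl ⟨hcI J, fun j j' => ?_⟩⟩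
      rw [← hI, hc J j, hc I j']
      exact ⟨h.lt_iff (pairIdx_lt _ _ _ _) (pairIdx_lt _ _ _ _),
        h.lt_iff (pairIdx_lt _ _ _ _) (pairIdx_lt _ _ _ _)⟩
    · exact ⟨c I, Finset.mem_image_of_mem _ (Finset.mem_univ _), .inr ⟨hcI I, hI⟩⟩
  · intro I hI
    exact ⟨c fun j => ⟨I j, hI j⟩, Finset.mem_image_of_mem _ (Finset.mem_univ _), hc _, hcI _⟩

/-- A hitting set gives a chain. -/
theorem exists_chain_of_hitting {Q k T : ℕ} (hQ : 0 < Q) {H : Finset ℕ}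
    (hH : H.card ≤ (k + 2) ^ Q)
    (hit : ∀ e < ((k + 2) * (T + 2)) ^ Q, ∀ f < ((k + 2) * (T + 2)) ^ Q, ∃ u ∈ H,
      u < ((k + 2) * (T + 2)) ^ Q ∧ ChainSet Q k T e f u) :
    ∃ s, IsChainSeq k T s ∧ ∀ u ∈ H, u < ((k + 2) * (T + 2)) ^ Q → Agrees Q k T s u := by
  set E := ((k + 2) * (T + 2)) ^ Q with hE
  set H' := H.filter (· < E) with hH'
  have hmem : ∀ u, u ∈ H' ↔ u ∈ H ∧ u < E := fun u => Finset.mem_filter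
  set φ : ℕ → Fin Q → Fin (k + 2) := fun u j => ⟨pairIdx k T u j, pairIdx_lt _ _ _ _⟩ with hφ
  have hsame : ∀ u u', SameIdx Q k T u u' ↔ φ u = φ u' := by
    intro u u'
    simp only [SameIdx, hφ, funext_iff, Fin.mk.injEq]
  have hsurj : ∀ I : Fin Q → Fin (k + 2), ∃ u ∈ H', φ u = I := by
    intro I
    obtain ⟨e, he, heI⟩ := exists_pairs (T := T) (fun j => (I j : ℕ)) (fun _ => 0)
      (fun j => (I j).2) fun _ => by omega
    have heI' : φ e = I := funext fun j => Fin.ext (heI j).1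
    -- For `f = e`, both alternatives of `ChainSet` require the indices of `e`.
    obtain ⟨u, hu, huE, hch⟩ := hit e he e he
    refine ⟨u, (hmem u).2 ⟨hu, huE⟩, ?_⟩
    rw [← heI', ← hsame]
    exact hch.elim And.left And.left
  -- All `(k + 2) ^ Q` index tuples occur within a budget of the same size, so each occurs exactly
  -- once.
  have hinj : Set.InjOn φ H' := by
    refine Finset.injOn_of_surjOn_of_card_le φ (t := Finset.univ) (fun _ _ => Finset.mem_coe.2
      (Finset.mem_univ _)) (fun I _ => ?_) ?_
    · obtain ⟨u, hu, h⟩ := hsurj I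
      exact ⟨u, hu, h⟩
    · refine ((Finset.card_filter_le _ _).trans hH).trans ?_
      simp
  have hcomp : ∀ u ∈ H', ∀ u' ∈ H', Compatible Q k T u u' := by
    intro u hu u' hu'
    -- By uniqueness, `w` is `u` in the first case; in the second it would be `u'`, which is
    -- excluded.
    obtain ⟨w, hw, hwE, ⟨h1, h2⟩ | ⟨h1, h2⟩⟩ := hit u' ((hmem u').1 hu').2 u ((hmem u).1 hu).2
    · obtain rfl := hinj ((hmem w).2 ⟨hw, hwE⟩) hu ((hsame _ _).1 h1)
      exact h2
    · exact absurd (hinj ((hmem w).2 ⟨hw, hwE⟩) hu' ((hsame _ _).1 h1)) h2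
  have hconst : ∀ i, ∃ u, i < k + 2 → u ∈ H' ∧ ∀ j : Fin Q, pairIdx k T u j = i := by
    intro i
    by_cases hi : i < k + 2
    · obtain ⟨u, hu, h⟩ := hsurj fun _ => ⟨i, hi⟩
      exact ⟨u, fun _ => ⟨hu, fun j => congrArg Fin.val (congrFun h j)⟩⟩
    · exact ⟨0, fun h => absurd h hi⟩
  choose h hh using hconst
  -- The term `s i` is read off the selected code all of whose indices are `i`; `0 < Q` ensures that
  -- it has a pair.
  refine ⟨fun i => pairVal k T (h i) 0, ⟨fun i _ => pairVal_lt _ _ _ _, ?_⟩, ?_⟩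
  · intro i hi i' hi' hlt
    have := (hcomp _ (hh i hi).1 _ (hh i' hi').1 ⟨0, hQ⟩ ⟨0, hQ⟩).1
    rw [(hh i hi).2, (hh i' hi').2] at this
    exact this.1 hlt
  · intro u hu huE j
    have hj := pairIdx_lt k T u j
    have := hcomp u ((hmem u).2 ⟨hu, huE⟩) _ (hh _ hj).1 j ⟨0, hQ⟩
    rw [(hh _ hj).2 ⟨0, hQ⟩] at this
    -- For equal indices, compatibility excludes both strict inequalities between the values.
    simp only [lt_irrefl, false_iff, not_lt] at this
    exact le_antisymm this.2 this.1

/-! ### Chains and sets of numbers -/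

/-- The chain `s` represents the set `C`. -/
def Represents (k : ℕ) (s : ℕ → ℕ) (C : Finset ℕ) : Prop :=
  ∀ c, c ∈ C ↔ ∃ i, 0 < i ∧ i < k + 1 ∧ s i = c + 1

/-- The chain lists `C` shifted by one in increasing order, between the sentinels `0` and `T + 1`.
The sentinels put every number below `T` into some gap. -/
theorem exists_chain {k T : ℕ} {C : Finset ℕ} (hC : ∀ c ∈ C, c < T) (hk : C.card = k) :
    ∃ s, IsChainSeq k T s ∧ Represents k s C ∧ s 0 = 0 ∧ s (k + 1) = T + 1 := by
  set D : Finset ℕ := insert 0 (insert (T + 1) (C.image (· + 1))) with hD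
  have h1 : T + 1 ∉ C.image (· + 1) := by
    intro h
    obtain ⟨c, hc, h⟩ := Finset.mem_image.1 h
    have := hC c hc
    omega
  have h0 : 0 ∉ insert (T + 1) (C.image (· + 1)) := by simp
  have hcard : D.card = k + 2 := by
    rw [hD, Finset.card_insert_of_notMem h0, Finset.card_insert_of_notMem h1,
      Finset.card_image_of_injective _ (add_left_injective 1), hk]
  have hDT : ∀ d ∈ D, d ≤ T + 1 := by
    intro d hd
    simp only [hD, Finset.mem_insert, Finset.mem_image] at hd
    rcases hd with rfl | rfl | ⟨c, hc, rfl⟩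
    · omega
    · omega
    · have := hC c hc
      omega
  set o := D.orderEmbOfFin hcard with ho
  set s : ℕ → ℕ := fun i => if h : i < k + 2 then o ⟨i, h⟩ else 0 with hs
  have hso : ∀ i (h : i < k + 2), s i = o ⟨i, h⟩ := fun i h => dif_pos h
  have hsD : ∀ i < k + 2, s i ∈ D := fun i h => by
    rw [hso i h]
    exact Finset.orderEmbOfFin_mem _ _ _
  have hmono : ∀ i < k + 2, ∀ j < k + 2, i < j → s i < s j := fun i hi j hj hij => by
    rw [hso i hi, hso j hj]
    exact o.strictMono hij
  have hsurj : ∀ d ∈ D, ∃ i < k + 2, s i = d := by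
    intro d hd
    have : d ∈ Set.range o := by rw [ho, Finset.range_orderEmbOfFin]; exact hd
    obtain ⟨i, rfl⟩ := this
    exact ⟨i, i.2, hso i i.2⟩
  have hs0 : s 0 = 0 := by
    obtain ⟨i, hi, h⟩ := hsurj 0 (by simp [hD])
    rcases Nat.eq_zero_or_pos i with rfl | hpos
    · exact h
    · have := hmono 0 (by omega) i hi hpos
      omega
  have hs1 : s (k + 1) = T + 1 := by
    obtain ⟨i, hi, h⟩ := hsurj (T + 1) (by simp [hD])
    rcases Nat.eq_or_lt_of_le (Nat.le_of_lt_succ hi) with rfl | hlt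
    · exact h
    · have := hmono i hi (k + 1) (by omega) hlt
      have := hDT _ (hsD (k + 1) (by omega))
      omega
  refine ⟨s, ⟨fun i hi => Nat.lt_succ_of_le (hDT _ (hsD i hi)), hmono⟩, fun c => ⟨fun hc => ?_, ?_⟩,
    hs0, hs1⟩
  · obtain ⟨i, hi, h⟩ := hsurj (c + 1) (by simp [hD, hc])
    refine ⟨i, Nat.pos_of_ne_zero ?_, lt_of_le_of_ne (by omega) ?_, h⟩
    · rintro rfl
      omega
    · rintro rfl
      have := hC c hc
      omega
  · rintro ⟨i, hi0, hi1, h⟩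
    have := hmono 0 (by omega) i (by omega) hi0
    have := hmono i (by omega) (k + 1) (by omega) hi1
    have := hsD i (by omega)
    simp only [hD, Finset.mem_insert, Finset.mem_image] at this
    rcases this with h' | h' | ⟨c', hc', h'⟩
    · omega
    · omega
    · obtain rfl : c' = c := by omega
      exact hc'

/-- By strict monotonicity the `k` inner terms lie in `1, …, T`, whatever the two end terms are. -/
theorem IsChainSeq.exists_finset {k T : ℕ} {s : ℕ → ℕ} (h : IsChainSeq k T s) :
    ∃ C : Finset ℕ, (∀ c ∈ C, c < T) ∧ C.card = k ∧ Represents k s C := by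
  have hpos : ∀ i, 0 < i → i < k + 1 → 0 < s i ∧ s i < T + 1 := fun i h0 h1 => by
    have := h.mono 0 (by omega) i (by omega) h0
    have := h.mono i (by omega) (k + 1) (by omega) h1
    have := h.lt (k + 1) (by omega)
    omega
  have hinj : Set.InjOn (fun i => s (i + 1) - 1) (Finset.range k) := by
    intro i hi j hj hij
    simp only [Finset.coe_range, Set.mem_Iio] at hi hj hij
    have := hpos (i + 1) (by omega) (by omega)
    have := hpos (j + 1) (by omega) (by omega)
    rcases lt_trichotomy i j with hlt | heq | hlt
    · have := h.mono (i + 1) (by omega) (j + 1) (by omega) (by omega)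
      omega
    · exact heq
    · have := h.mono (j + 1) (by omega) (i + 1) (by omega) (by omega)
      omega
  refine ⟨(Finset.range k).image fun i => s (i + 1) - 1, ?_, ?_, fun c => ?_⟩
  · intro c hc
    obtain ⟨i, hi, rfl⟩ := Finset.mem_image.1 hc
    have := Finset.mem_range.1 hi
    have := hpos (i + 1) (by omega) (by omega)
    omega
  · rw [Finset.card_image_of_injOn hinj, Finset.card_range]
  · simp only [Finset.mem_image, Finset.mem_range]
    constructor
    · rintro ⟨i, hi, rfl⟩
      have := hpos (i + 1) (by omega) (by omega)
      exact ⟨i + 1, by omega, by omega, by omega⟩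
    · rintro ⟨i, h0, h1, hs⟩
      exact ⟨i - 1, by omega, by rw [Nat.sub_add_cancel h0]; omega⟩

/-- The pairs of `u` include two consecutive ones between which `c + 1` lies. -/
def GapDefined (Q k T u c : ℕ) : Prop :=
  ∃ j j' : Fin Q, pairIdx k T u j' = pairIdx k T u j + 1 ∧ pairVal k T u j ≤ c + 1 ∧
    c + 1 < pairVal k T u j'

/-- The pairs of `u` include an inner one with value `c + 1`. -/
def HasValue (Q k T u c : ℕ) : Prop :=
  ∃ j : Fin Q, 0 < pairIdx k T u j ∧ pairIdx k T u j < k + 1 ∧ pairVal k T u j = c + 1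

/-- If `c + 1` lies between consecutive terms, the lower included, then it can occur in the chain
only as the lower one. So two pairs decide both membership and non-membership. -/
theorem hasValue_iff {Q k T u c : ℕ} {s : ℕ → ℕ} {C : Finset ℕ} (hs : IsChainSeq k T s)
    (hC : Represents k s C) (hu : Agrees Q k T s u) (hd : GapDefined Q k T u c) :
    HasValue Q k T u c ↔ c ∈ C := by
  rw [hC]
  constructor
  · rintro ⟨j, h0, h1, h2⟩
    exact ⟨_, h0, h1, by rw [← hu j, h2]⟩
  · rintro ⟨i, h0, h1, h2⟩
    obtain ⟨j, j', hjj, hj, hj'⟩ := hd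
    have e1 := pairIdx_lt k T u j
    have e2 := pairIdx_lt k T u j'
    rw [hu j, ← h2] at hj
    rw [hu j', ← h2, ← hs.lt_iff (by omega) e2] at hj'
    have h3 := (hs.lt_iff (i := i) (by omega) e1).not.2 (by omega)
    obtain rfl : i = pairIdx k T u j := by omega
    exact ⟨j, h0, h1, by rw [hu j, h2]⟩

/-- If no gap contained `c + 1`, induction would keep all terms at or below it, but the last one is
`T + 1`. -/
theorem exists_gap {k T c : ℕ} {s : ℕ → ℕ} (h0 : s 0 = 0) (h1 : s (k + 1) = T + 1) (hc : c < T) :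
    ∃ i < k + 1, s i ≤ c + 1 ∧ c + 1 < s (i + 1) := by
  by_contra! h
  have : ∀ i ≤ k + 1, s i ≤ c + 1 := by
    intro i
    induction i with
    | zero => intro _; omega
    | succ i ih => exact fun hi => h i (by omega) (ih (by omega))
  have := this (k + 1) le_rfl
  omega

/-! ### The formula -/

section terms

variable {α : Type} [Ctx α] {fn fk fT fu fc : α → ℕ}

theorem TmFun.pairIdx (hk : TmFun fk) (hT : TmFun fT) (hu : TmFun fu) (j : ℕ) :
    TmFun fun a => pairIdx (fk a) (fT a) (fu a) j :=
  have hT2 := hT.add (TmFun.const 2)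
  have hD := (hk.add (TmFun.const 2)).mul hT2
  ((hu.div (hD.pow j)).mod hD).div hT2

theorem TmFun.pairVal (hk : TmFun fk) (hT : TmFun fT) (hu : TmFun fu) (j : ℕ) :
    TmFun fun a => pairVal (fk a) (fT a) (fu a) j :=
  have hT2 := hT.add (TmFun.const 2)
  have hD := (hk.add (TmFun.const 2)).mul hT2
  ((hu.div (hD.pow j)).mod hD).mod hT2

theorem TmRel.gapDefined (Q : ℕ) (hk : TmFun fk) (hT : TmFun fT) (hu : TmFun fu) (hc : TmFun fc) :
    TmRel fun a => GapDefined Q (fk a) (fT a) (fu a) (fc a) :=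
  have hi := TmFun.pairIdx hk hT hu
  have hv := TmFun.pairVal hk hT hu
  have hc1 := hc.add (TmFun.const 1)
  .finEx fun j => .finEx fun j' => (TmRel.eq (hi j') ((hi j).add (TmFun.const 1))).and
    ((TmRel.le (hv j) hc1).and (TmRel.lt hc1 (hv j')))

theorem TmRel.hasValue (Q : ℕ) (hk : TmFun fk) (hT : TmFun fT) (hu : TmFun fu) (hc : TmFun fc) :
    TmRel fun a => HasValue Q (fk a) (fT a) (fu a) (fc a) :=
  have hi := TmFun.pairIdx hk hT hu
  have hv := TmFun.pairVal hk hT hu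
  .finEx fun j => (TmRel.lt (TmFun.const 0) (hi j)).and
    ((TmRel.lt (hi j) (hk.add (TmFun.const 1))).and (TmRel.eq (hv j) (hc.add (TmFun.const 1))))

theorem TmFun.tableOffset {τ : Vocab} (i : Fin τ.num) (hn : TmFun fn) :
    TmFun fun a => tableOffset (tableLength τ (fn a)) i := by
  refine TmFun.finsetSum Finset.univ fun j => ?_
  by_cases h : j < i
  · exact (hn.pow (τ.arity j)).congr fun a => by simp [h, tableLength]
  · exact (TmFun.const 0).congr fun a => by simp [h]

end terms

/-- The number that codes the tuple `v` over `{0, …, n - 1}`. -/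
def tupleCode {l : ℕ} (n : ℕ) (v : Fin l → ℕ) : ℕ := ∑ j, v j * n ^ (j : ℕ)

theorem TmFun.tupleCode {α : Type} [Ctx α] {fn : α → ℕ} {l : ℕ} {fv : Fin l → α → ℕ}
    (hn : TmFun fn) (hv : ∀ j, TmFun (fv j)) : TmFun fun a => tupleCode (fn a) fun j => fv j a :=
  TmFun.finsetSum Finset.univ fun j => (hv j).mul (hn.pow j)

/-- The relations between a word, the size of the structure that it encodes, the parameter, the code
of a list of pairs, and a tuple. -/
abbrev HitRel (m : ℕ) : Type := (ℕ → ℕ) → ℕ → ℕ → ℕ → (Fin m → ℕ) → Prop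

/-- The relation `R` is given by a term. -/
def HitRel.IsTm {m : ℕ} (R : HitRel m) : Prop :=
  ∀ {α : Type} [Ctx α] {fn fk fu : α → ℕ} {fv : Fin m → α → ℕ}, TmFun fn → TmFun fk → TmFun fu →
    (∀ i, TmFun (fv i)) → TmRel fun a => R (Ctx.word a) (fn a) (fk a) (fu a) fun i => fv i a

/-! ### Evaluating formulas from boundedly many terms of the chain -/

section realize

variable {τ : Vocab} {r : ℕ} {hr : 0 < r}

/-- The formula `φ` is true in the expansion of `A` by `S` under the assignment `v`. -/
def RealizeAt (A : FinStruct τ) (S : Finset (Fin r → Fin A.size)) {m : ℕ}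
    (φ : (τ.extend r hr).lang.BoundedFormula Empty m) (v : Fin m → Fin A.size) : Prop :=
  @FirstOrder.Language.BoundedFormula.Realize _ (Fin A.size)
    ((A.expand r hr S).induced (M := Fin A.size) id) _ _ φ Empty.elim v

/-- The word that encodes `A`, as a sequence of numbers. -/
def FinStruct.word (A : FinStruct τ) (i : ℕ) : ℕ := (A.encode.map Fin.val).getD i 0

theorem FinStruct.word_eq_one_iff (A : FinStruct τ) (i : Fin τ.num)
    (a : Fin (τ.arity i) → Fin A.size) :
    A.word (A.size + 1 + (tableOffset (tableLength τ A.size) i +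
      tupleCode A.size fun j => (a j : ℕ))) = 1 ↔ A.rel i a = true := by
  have h := A.getD_encode i a
  have h' : A.word (A.size + 1 + (tableOffset (tableLength τ A.size) i +
      tupleCode A.size fun j => (a j : ℕ))) = ((if A.rel i a then 1 else 0 : Fin 2) : ℕ) := by
    rw [← h]
    exact List.getD_map (f := Fin.val) (d := (0 : Fin 2)) ..
  rw [h']
  cases A.rel i a <;> simp

/-- The chain `s` represents the set `S` of tuples. -/
structure ChainFor (A : FinStruct τ) (S : Finset (Fin r → Fin A.size)) (k : ℕ) (s : ℕ → ℕ) :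
    Prop where
  isChainSeq : IsChainSeq k (A.size ^ r) s
  represents : Represents k s (S.image fun a => (finFunctionFinEquiv a : ℕ))

theorem ChainFor.hasValue_iff {A : FinStruct τ} {S : Finset (Fin r → Fin A.size)} {k : ℕ}
    {s : ℕ → ℕ} (h : ChainFor A S k s) {Q u : ℕ} (hu : Agrees Q k (A.size ^ r) s u)
    (a : Fin r → Fin A.size)
    (hd : GapDefined Q k (A.size ^ r) u (tupleCode A.size fun j => (a j : ℕ))) :
    HasValue Q k (A.size ^ r) u (tupleCode A.size fun j => (a j : ℕ)) ↔ a ∈ S := by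
  rw [VertexDeletion.hasValue_iff h.isChainSeq h.represents hu hd]
  exact Function.Injective.mem_finset_image
    (Fin.val_injective.comp finFunctionFinEquiv.injective)

/-- For the codes of lists of pairs that agree with the chain of `S` and for which `df` holds, `tr`
says whether `φ` is true. If the list includes certain `q` indices, then `df` holds. -/
structure Evaluates (q Q : ℕ) {m : ℕ} (φ : (τ.extend r hr).lang.BoundedFormula Empty m)
    (df tr : HitRel m) : Prop where
  df_isTm : df.IsTm
  tr_isTm : tr.IsTm
  iff : ∀ {A : FinStruct τ} {S : Finset (Fin r → Fin A.size)} {k : ℕ} {s : ℕ → ℕ},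
    ChainFor A S k s → ∀ u, Agrees Q k (A.size ^ r) s u → ∀ v : Fin m → Fin A.size,
    df A.word A.size k u (fun i => v i) → (tr A.word A.size k u (fun i => v i) ↔ RealizeAt A S φ v)
  exists_list : ∀ {A : FinStruct τ} {S : Finset (Fin r → Fin A.size)} {k : ℕ} {s : ℕ → ℕ},
    ChainFor A S k s → s 0 = 0 → s (k + 1) = A.size ^ r + 1 → ∀ v : Fin m → Fin A.size,
    ∃ l : List ℕ, l.length ≤ q ∧ (∀ i ∈ l, i < k + 2) ∧ ∀ u, Agrees Q k (A.size ^ r) s u →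
      (∀ i ∈ l, ∃ j : Fin Q, pairIdx k (A.size ^ r) u j = i) →
      df A.word A.size k u (fun i => v i)

theorem exists_eq_var {m : ℕ} (t : (τ.extend r hr).lang.Term (Empty ⊕ Fin m)) :
    ∃ i : Fin m, t = &i := by
  cases t with
  | var x =>
    cases x with
    | inl e => exact e.elim
    | inr i => exact ⟨i, rfl⟩
  | func f _ => exact nomatch f

/-- For formulas whose truth can be read off the word and the assignment alone; no index of the
chain is needed. -/
theorem evaluates_of_total {Q : ℕ} {m : ℕ} {φ : (τ.extend r hr).lang.BoundedFormula Empty m}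
    {tr : HitRel m} (htr : tr.IsTm)
    (h : ∀ (A : FinStruct τ) (S : Finset (Fin r → Fin A.size)) (k u : ℕ) (v : Fin m → Fin A.size),
      tr A.word A.size k u (fun i => v i) ↔ RealizeAt A S φ v) :
    Evaluates 0 Q φ (fun _ _ _ _ _ => True) tr where
  df_isTm _ _ _ _ := TmRel.const True
  tr_isTm := htr
  iff _ u _ v _ := h _ _ _ u v
  exists_list _ _ _ _ := ⟨[], le_rfl, by simp, fun _ _ _ => trivial⟩

/-- Equalities and atoms over `τ` need nothing from the chain. An atom of the new symbol needs the
two ends of the gap around the code of its tuple, hence `q = 2`. -/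
theorem exists_evaluates_of_isAtomic {m : ℕ} {φ : (τ.extend r hr).lang.BoundedFormula Empty m}
    (hφ : φ.IsAtomic) : ∃ q, ∀ Q, ∃ df tr, Evaluates q Q φ df tr := by
  cases hφ with
  | equal t₁ t₂ =>
    obtain ⟨i, rfl⟩ := exists_eq_var t₁
    obtain ⟨j, rfl⟩ := exists_eq_var t₂
    refine ⟨0, fun Q => ⟨_, fun _ _ _ _ v => v i = v j, evaluates_of_total
      (fun _ _ _ hv => TmRel.eq (hv i) (hv j)) fun A S k u v => ?_⟩⟩
    exact Fin.val_inj
  | @rel l R ts =>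
    choose x hx using fun j => exists_eq_var (ts j)
    obtain rfl : ts = fun j => &(x j) := funext hx
    obtain ⟨i, h⟩ := R
    cases i using Fin.cases with
    | zero =>
      obtain rfl : r = l := h
      refine ⟨2, fun Q => ⟨fun _ n k u v => GapDefined Q k (n ^ r) u (tupleCode n fun j => v (x j)),
        fun _ n k u v => HasValue Q k (n ^ r) u (tupleCode n fun j => v (x j)),
        fun hn hk hu hv => TmRel.gapDefined Q hk (hn.pow r) hu (hn.tupleCode fun j => hv (x j)),
        fun hn hk hu hv => TmRel.hasValue Q hk (hn.pow r) hu (hn.tupleCode fun j => hv (x j)),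
        fun hs u hu v hd => ?_, fun {A S k s} hs h0 h1 v => ?_⟩⟩
      · refine (hs.hasValue_iff hu (fun j => v (x j)) hd).trans ?_
        exact decide_eq_true_iff.symm
      · obtain ⟨i, hi, hi1, hi2⟩ := exists_gap h0 h1
          (Fin.is_lt (finFunctionFinEquiv fun j => v (x j)))
        refine ⟨[i, i + 1], le_rfl, by simp; omega, fun u hu hl => ?_⟩
        obtain ⟨j, hj⟩ := hl i (by simp)
        obtain ⟨j', hj'⟩ := hl (i + 1) (by simp)
        refine ⟨j, j', by rw [hj, hj'], ?_, ?_⟩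
        · rw [hu j, hj]
          exact hi1
        · rw [hu j', hj']
          exact hi2
    | succ i =>
      obtain rfl : τ.arity i = l := h
      refine ⟨0, fun Q => ⟨_, fun w n _ _ v => w (n + 1 + (tableOffset (tableLength τ n) i +
        tupleCode n fun j => v (x j))) = 1, evaluates_of_total
        (fun hn _ _ hv => TmRel.eq (TmFun.word ((hn.add (TmFun.const 1)).add ((hn.tableOffset i).add
          (hn.tupleCode fun j => hv (x j))))) (TmFun.const 1)) fun A S k u v => ?_⟩⟩
      exact A.word_eq_one_iff i fun j => v (x j)

/-- Since `tr` gives the exact truth value where `df` holds, it commutes with implication; `df` is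
required of both sides, and the index lists are concatenated. -/
theorem exists_evaluates_of_isQF {m : ℕ} {φ : (τ.extend r hr).lang.BoundedFormula Empty m}
    (hφ : φ.IsQF) : ∃ q, ∀ Q, ∃ df tr, Evaluates q Q φ df tr := by
  induction hφ with
  | falsum =>
    exact ⟨0, fun Q => ⟨_, fun _ _ _ _ _ => False, evaluates_of_total
      (fun _ _ _ _ => TmRel.const False) fun _ _ _ _ _ => Iff.rfl⟩⟩
  | of_isAtomic h => exact exists_evaluates_of_isAtomic h
  | imp _ _ ih₁ ih₂ =>
    obtain ⟨q₁, h₁⟩ := ih₁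
    obtain ⟨q₂, h₂⟩ := ih₂
    refine ⟨q₁ + q₂, fun Q => ?_⟩
    obtain ⟨d₁, t₁, e₁⟩ := h₁ Q
    obtain ⟨d₂, t₂, e₂⟩ := h₂ Q
    refine ⟨fun w n k u v => d₁ w n k u v ∧ d₂ w n k u v,
      fun w n k u v => t₁ w n k u v → t₂ w n k u v,
      fun hn hk hu hv => (e₁.df_isTm hn hk hu hv).and (e₂.df_isTm hn hk hu hv),
      fun hn hk hu hv => (e₁.tr_isTm hn hk hu hv).imp (e₂.tr_isTm hn hk hu hv),
      fun hs u hu v hd => imp_congr (e₁.iff hs u hu v hd.1) (e₂.iff hs u hu v hd.2),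
      fun hs h0 h1 v => ?_⟩
    obtain ⟨l₁, hl₁, hk₁, hd₁⟩ := e₁.exists_list hs h0 h1 v
    obtain ⟨l₂, hl₂, hk₂, hd₂⟩ := e₂.exists_list hs h0 h1 v
    refine ⟨l₁ ++ l₂, by simp; omega, ?_, fun u hu hl => ⟨hd₁ u hu ?_, hd₂ u hu ?_⟩⟩
    · simp only [List.mem_append]
      rintro i (hi | hi)
      exacts [hk₁ i hi, hk₂ i hi]
    · exact fun i hi => hl i (List.mem_append_left _ hi)
    · exact fun i hi => hl i (List.mem_append_right _ hi)

/-- For the codes of lists of pairs that agree with the chain of `S`, `hit` implies `φ`. Conversely,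
if `φ` is true, and the list includes certain `q` indices, then `hit` holds. -/
structure Witnesses (q Q : ℕ) {m : ℕ} (φ : (τ.extend r hr).lang.BoundedFormula Empty m)
    (hit : HitRel m) : Prop where
  isTm : hit.IsTm
  realize : ∀ {A : FinStruct τ} {S : Finset (Fin r → Fin A.size)} {k : ℕ} {s : ℕ → ℕ},
    ChainFor A S k s → ∀ u, Agrees Q k (A.size ^ r) s u → ∀ v : Fin m → Fin A.size,
    hit A.word A.size k u (fun i => v i) → RealizeAt A S φ v
  exists_list : ∀ {A : FinStruct τ} {S : Finset (Fin r → Fin A.size)} {k : ℕ} {s : ℕ → ℕ},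
    ChainFor A S k s → s 0 = 0 → s (k + 1) = A.size ^ r + 1 → ∀ v : Fin m → Fin A.size,
    RealizeAt A S φ v →
    ∃ l : List ℕ, l.length ≤ q ∧ (∀ i ∈ l, i < k + 2) ∧ ∀ u, Agrees Q k (A.size ^ r) s u →
      (∀ i ∈ l, ∃ j : Fin Q, pairIdx k (A.size ^ r) u j = i) →
      hit A.word A.size k u (fun i => v i)

theorem val_snoc {m n : ℕ} (v : Fin m → Fin n) (b : Fin n) :
    (fun i => ((Fin.snoc v b : Fin (m + 1) → Fin n) i : ℕ)) =
      (Fin.snoc (fun i => (v i : ℕ)) (b : ℕ) : Fin (m + 1) → ℕ) := by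
  funext i
  cases i using Fin.lastCases <;> simp

/-- Existential witnesses are found by a bounded quantifier inside the term and are not coded in
`u`, so they do not increase `q`. -/
theorem exists_witnesses {e m : ℕ} {φ : (τ.extend r hr).lang.BoundedFormula Empty m}
    (hφ : HasPattern (List.replicate e Quant.e) φ) : ∃ q, ∀ Q, ∃ hit, Witnesses q Q φ hit := by
  induction e generalizing m with
  | zero =>
    rw [List.replicate_zero] at hφ
    cases hφ with
    | qf h =>
      obtain ⟨q, h⟩ := exists_evaluates_of_isQF h
      refine ⟨q, fun Q => ?_⟩
      obtain ⟨df, tr, e⟩ := h Q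
      refine ⟨fun w n k u v => df w n k u v ∧ tr w n k u v,
        fun hn hk hu hv => (e.df_isTm hn hk hu hv).and (e.tr_isTm hn hk hu hv),
        fun hs u hu v h => (e.iff hs u hu v h.1).1 h.2, fun hs h0 h1 v h => ?_⟩
      obtain ⟨l, hl, hk, hd⟩ := e.exists_list hs h0 h1 v
      exact ⟨l, hl, hk, fun u hu hl => ⟨hd u hu hl, (e.iff hs u hu v (hd u hu hl)).2 h⟩⟩
  | succ e ih =>
    rw [List.replicate_succ] at hφ
    cases hφ with
    | @ex _ _ φ h =>
      obtain ⟨q, h⟩ := ih h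
      refine ⟨q, fun Q => ?_⟩
      obtain ⟨hit, e⟩ := h Q
      have hreal : ∀ (A : FinStruct τ) (S : Finset (Fin r → Fin A.size)) (v : Fin m → Fin A.size),
          RealizeAt A S φ.ex v ↔ ∃ b, RealizeAt A S φ (Fin.snoc v b) := fun A S v => by
        let _ := (A.expand r hr S).induced (M := Fin A.size) id
        exact FirstOrder.Language.BoundedFormula.realize_ex
      refine ⟨fun w n k u v => ∃ b < n, hit w n k u (Fin.snoc v b),
        fun {α _ fn fk fu fv} hn hk hu hv => ?_, fun hs u hu v h => ?_, fun hs h0 h1 v h => ?_⟩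
      · refine TmRel.ex hn ((e.isTm hn.weaken hk.weaken hu.weaken
          (fv := Fin.snoc (α := fun _ => Ext α → ℕ) (fun i a => fv i a.fst) fun a => a.snd)
          fun i => ?_).congr fun a => ?_)
        · cases i using Fin.lastCases with
          | last => rw [Fin.snoc_last]; exact TmFun.snd
          | cast i => rw [Fin.snoc_castSucc]; exact (hv i).weaken
        · refine iff_of_eq (congrArg _ (funext fun i => ?_))
          cases i using Fin.lastCases <;> simp
      · obtain ⟨b, hb, h⟩ := h
        refine (hreal _ _ _).2 ⟨⟨b, hb⟩, e.realize hs u hu _ ?_⟩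
        rw [val_snoc]
        exact h
      · obtain ⟨b, hb⟩ := (hreal _ _ _).1 h
        obtain ⟨l, hl, hk, hd⟩ := e.exists_list hs h0 h1 _ hb
        refine ⟨l, hl, hk, fun u hu hl => ⟨b, b.2, ?_⟩⟩
        have := hd u hu hl
        rwa [val_snoc] at this

/-- For truth under all assignments, leading universal quantifiers can be dropped. The assignments
to the resulting free variables index the sets of kind `3`. -/
theorem exists_universal_closure {a m : ℕ} {p : List Quant}
    {φ : (τ.extend r hr).lang.BoundedFormula Empty m}
    (hφ : HasPattern (List.replicate a Quant.a ++ p) φ) :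
    ∃ (m' : ℕ) (ψ : (τ.extend r hr).lang.BoundedFormula Empty m'), HasPattern p ψ ∧
      ∀ (A : FinStruct τ) (S : Finset (Fin r → Fin A.size)),
        (∀ v, RealizeAt A S φ v) ↔ ∀ v, RealizeAt A S ψ v := by
  induction a generalizing m with
  | zero => exact ⟨m, φ, hφ, fun _ _ => Iff.rfl⟩
  | succ a ih =>
    rw [List.replicate_succ, List.cons_append] at hφ
    cases hφ with
    | @all _ _ φ h =>
      obtain ⟨m', ψ, hψ, h⟩ := ih h
      refine ⟨m', ψ, hψ, fun A S => Iff.trans ?_ (h A S)⟩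
      have hreal : ∀ v : Fin m → Fin A.size,
          RealizeAt A S φ.all v ↔ ∀ b, RealizeAt A S φ (Fin.snoc v b) := fun v => Iff.rfl
      simp only [hreal]
      refine ⟨fun h v => ?_, fun h v b => h _⟩
      have := h (Fin.init v) (v (Fin.last m))
      rwa [Fin.snoc_init_self] at this

theorem expand_models_iff (A : FinStruct τ) (S : Finset (Fin r → Fin A.size))
    (φ : (τ.extend r hr).lang.Sentence) :
    (A.expand r hr S).Models φ ↔ ∀ v, RealizeAt A S φ v := by
  constructor
  · intro h v
    have h' : RealizeAt A S φ default := by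
      refine cast ?_ h
      unfold FinStruct.Models RealizeAt FirstOrder.Language.Sentence.Realize
        FirstOrder.Language.Formula.Realize
      congr 1
      exact Subsingleton.elim (α := Empty → Fin A.size) _ _
    rwa [Subsingleton.elim v default]
  · intro h
    refine cast ?_ (h default)
    unfold FinStruct.Models RealizeAt FirstOrder.Language.Sentence.Realize
      FirstOrder.Language.Formula.Realize
    congr 1
    exact Subsingleton.elim (α := Empty → Fin A.size) _ _

end realize

/-! ### The set system of a formula -/

/-- The number of codes of lists of pairs. -/
def codeBound (Q r n k : ℕ) : ℕ := ((k + 2) * (n ^ r + 2)) ^ Q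

/-- The number of different sets. -/
def setBound (Q r m n k : ℕ) : ℕ := codeBound Q r n k * codeBound Q r n k * n ^ m

/-- The number of codes of elements and sets; every set has `(k + 2) ^ Q + 2` codes. -/
def payloadBound (Q r m n k : ℕ) : ℕ := setBound Q r m n k * ((k + 2) ^ Q + 2)

/-- The set system: the sets of kind `2` enforce that a chain is selected, and the others
correspond to the assignments of the universally quantified variables. -/
def SetMem (Q r : ℕ) {m : ℕ} (hit : HitRel m) (w : ℕ → ℕ) (n k v u : ℕ) : Prop :=
  u < codeBound Q r n k ∧
    ((v % 5 = 2 ∧ ChainSet Q k (n ^ r) (v / 5 % codeBound Q r n k)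
        (v / 5 / codeBound Q r n k % codeBound Q r n k) u) ∨
      (v % 5 ≠ 2 ∧ hit w n k u fun i => v / 5 / n ^ (i : ℕ) % n))

/-- `p / x % y` depends only on `p` modulo `x * y`. Hence shifting the number of a set by a multiple
of `setBound` gives a copy of it. -/
theorem div_mod_congr {p p' x y M : ℕ} (hM : x * y ∣ M) (h : p' % M = p % M) :
    p' / x % y = p / x % y := by
  rw [← Nat.mod_mul_right_div_self, ← Nat.mod_mul_right_div_self, ← Nat.mod_mod_of_dvd p' hM, h,
    Nat.mod_mod_of_dvd p hM]

theorem codeBound_pos (Q r n k : ℕ) : 0 < codeBound Q r n k := by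
  unfold codeBound
  positivity

theorem setBound_pos {Q r m n k : ℕ} (hn : 0 < n) : 0 < setBound Q r m n k :=
  Nat.mul_pos (Nat.mul_pos (codeBound_pos _ _ _ _) (codeBound_pos _ _ _ _)) (Nat.pow_pos hn)

theorem setBound_le_payloadBound (Q r m n k : ℕ) : setBound Q r m n k ≤ payloadBound Q r m n k :=
  Nat.le_mul_of_pos_right _ (by omega)

theorem two_le_payloadBound {Q r m n k : ℕ} (hn : 0 < n) : 2 ≤ payloadBound Q r m n k :=
  Nat.mul_le_mul (setBound_pos (Q := Q) (r := r) (m := m) (k := k) hn)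
    (by omega : 2 ≤ (k + 2) ^ Q + 2)

/-- The copies are obtained by adding multiples of `setBound` to the reduced number of the set;
`payloadBound` leaves room for `(k + 2) ^ Q + 2` of them. -/
theorem exists_copies {Q r m : ℕ} {hit : HitRel m} {w : ℕ → ℕ} {n k : ℕ} (hn : 0 < n) (v : ℕ)
    (hv : v % 5 = 2 ∨ v % 5 = 3) :
    ∃ C : Finset ℕ, (k + 2) ^ Q + 2 ≤ C.card ∧ ∀ v' ∈ C,
      v' < 5 * payloadBound Q r m n k ∧ (v' % 5 = 2 ∨ v' % 5 = 3) ∧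
        ∀ u, SetMem Q r hit w n k v' u → SetMem Q r hit w n k v u := by
  set M := setBound Q r m n k with hM
  have hM0 : 0 < M := setBound_pos hn
  set c : ℕ → ℕ := fun i => 5 * (v / 5 % M + M * i) + v % 5 with hc
  have hinj : Function.Injective c := fun i j hij => by
    simp only [hc] at hij
    exact Nat.eq_of_mul_eq_mul_left hM0 (by omega)
  refine ⟨(Finset.range ((k + 2) ^ Q + 2)).image c, ?_, ?_⟩
  · rw [Finset.card_image_of_injective _ hinj, Finset.card_range]
  · intro v' hv'
    obtain ⟨i, hi, rfl⟩ := Finset.mem_image.1 hv'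
    have hi' := Finset.mem_range.1 hi
    have h5 : c i % 5 = v % 5 := by simp only [hc]; omega
    have hd : c i / 5 = v / 5 % M + M * i := by simp only [hc]; omega
    have hmod : c i / 5 % M = v / 5 % M := by
      rw [hd, Nat.add_mul_mod_self_left, Nat.mod_mod]
    refine ⟨?_, by omega, fun u ⟨hu, h⟩ => ⟨hu, ?_⟩⟩
    · have h1 : M * (i + 1) ≤ payloadBound Q r m n k := Nat.mul_le_mul_left M hi'
      have h2 := Nat.mod_lt (v / 5) hM0
      rw [Nat.mul_succ] at h1
      have h3 : c i / 5 < payloadBound Q r m n k := by omega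
      omega
    · have e1 : c i / 5 % codeBound Q r n k = v / 5 % codeBound Q r n k := by
        have := div_mod_congr (x := 1) (y := codeBound Q r n k)
          (by rw [one_mul]; exact (Dvd.intro _ rfl : _ ∣ _ * _).trans (Dvd.intro _ rfl)) hmod
        simpa using this
      have e2 : c i / 5 / codeBound Q r n k % codeBound Q r n k =
          v / 5 / codeBound Q r n k % codeBound Q r n k :=
        div_mod_congr (Dvd.intro _ rfl) hmod
      have e3 : ∀ j : Fin m, c i / 5 / n ^ (j : ℕ) % n = v / 5 / n ^ (j : ℕ) % n := fun j =>
        div_mod_congr (by rw [← pow_succ]; exact (pow_dvd_pow n j.2).trans (Dvd.intro_left _ rfl))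
          hmod
      simpa only [h5, e1, e2, e3] using h

/-! ### Hitting sets of the set system versus solutions of the formula -/

section hitting

variable {τ : Vocab} {r : ℕ} {hr : 0 < r}

/-- The sets of kind `2` yield a chain, hence a relation with `k` tuples; those of kind `3` say that
`ψ` holds under every assignment. There are `q + 1` pairs so that there is at least one. -/
theorem exists_hitting_iff {q m : ℕ} {ψ : (τ.extend r hr).lang.BoundedFormula Empty m}
    {hit : HitRel m} (hψ : Witnesses q (q + 1) ψ hit) (A : FinStruct τ) (k : ℕ) :
    (∃ H : Finset ℕ, H.card ≤ (k + 2) ^ (q + 1) ∧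
      (∀ u ∈ H, u < payloadBound (q + 1) r m A.size k) ∧
      ∀ v < 5 * payloadBound (q + 1) r m A.size k, v % 5 = 2 ∨ v % 5 = 3 →
        ∃ u ∈ H, SetMem (q + 1) r hit A.word A.size k v u) ↔
    ∃ S : Finset (Fin r → Fin A.size), S.card = k ∧ ∀ v, RealizeAt A S ψ v := by
  set E := codeBound (q + 1) r A.size k with hE
  have hE0 : 0 < E := codeBound_pos _ _ _ _
  have hB := setBound_le_payloadBound (q + 1) r m A.size k
  have hn : 0 < A.size ^ m := Nat.pow_pos A.size_pos
  have hEE : E * E ≤ payloadBound (q + 1) r m A.size k :=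
    (Nat.le_mul_of_pos_right _ hn).trans hB
  have hcode : Function.Injective fun a : Fin r → Fin A.size => (finFunctionFinEquiv a : ℕ) :=
    Fin.val_injective.comp finFunctionFinEquiv.injective
  constructor
  · rintro ⟨H, hHK, -, hH⟩
    obtain ⟨s, hs, hsH⟩ := exists_chain_of_hitting (Nat.succ_pos q) (T := A.size ^ r) hHK
      (fun e he f hf => by
        change e < E at he
        change f < E at hf
        have h1 : E * (f + 1) ≤ E * E := Nat.mul_le_mul_left E hf
        rw [Nat.mul_succ] at h1
        -- The set numbered `E * f + e` decodes to the chain set of `e` and `f`.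
        obtain ⟨u, hu, huE, ⟨-, h⟩ | ⟨h, -⟩⟩ := hH (5 * (E * f + e) + 2) (by omega) (by omega)
        · refine ⟨u, hu, huE, ?_⟩
          rw [show (5 * (E * f + e) + 2) / 5 = E * f + e by omega, ← hE, Nat.mul_add_mod,
            Nat.mod_eq_of_lt he, Nat.mul_add_div hE0, Nat.div_eq_of_lt he, Nat.add_zero f,
            Nat.mod_eq_of_lt hf] at h
          exact h
        · omega)
    obtain ⟨C, hCT, hCk, hC⟩ := hs.exists_finset
    set S : Finset (Fin r → Fin A.size) := Finset.univ.filter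
      fun a => (finFunctionFinEquiv a : ℕ) ∈ C with hS
    have hSC : S.image (fun a => (finFunctionFinEquiv a : ℕ)) = C := by
      ext c
      simp only [hS, Finset.mem_image, Finset.mem_filter, Finset.mem_univ, true_and]
      constructor
      · rintro ⟨a, ha, rfl⟩
        exact ha
      · intro hc
        refine ⟨finFunctionFinEquiv.symm ⟨c, hCT c hc⟩, ?_, ?_⟩
        · rw [Equiv.apply_symm_apply]
          exact hc
        · rw [Equiv.apply_symm_apply]
    refine ⟨S, ?_, fun v => ?_⟩
    · rw [← hCk, ← hSC, Finset.card_image_of_injective _ hcode]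
    · obtain ⟨a, ha, hav⟩ := exists_digits v
      have h2 : A.size ^ m ≤ setBound (q + 1) r m A.size k :=
        Nat.le_mul_of_pos_left _ (Nat.mul_pos hE0 hE0)
      obtain ⟨u, hu, huE, ⟨h, -⟩ | ⟨-, h⟩⟩ := hH (5 * a + 3) (by omega) (by omega)
      · omega
      · refine hψ.realize ⟨hs, hSC.symm ▸ hC⟩ u (hsH u hu huE) v ?_
        rw [show (5 * a + 3) / 5 = a by omega] at h
        simpa only [hav] using h
  · rintro ⟨S, hSk, hS⟩
    obtain ⟨s, hs, hC, h0, h1⟩ := exists_chain (T := A.size ^ r)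
      (C := S.image fun a => (finFunctionFinEquiv a : ℕ)) (by
        intro c hc
        obtain ⟨a, -, rfl⟩ := Finset.mem_image.1 hc
        exact Fin.is_lt _) ((Finset.card_image_of_injective _ hcode).trans hSk)
    obtain ⟨H, hHK, hHE, hch, hag⟩ := hs.exists_hitting (q + 1)
    refine ⟨H, hHK, fun u hu => (hHE u hu).trans_le ((Nat.le_mul_of_pos_right E hE0).trans hEE),
      fun v _ hv => ?_⟩
    rcases hv with hv | hv
    · obtain ⟨u, hu, h⟩ := hch (v / 5 % E) (v / 5 / E % E)
      exact ⟨u, hu, hHE u hu, .inl ⟨hv, h⟩⟩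
    · obtain ⟨l, hlq, hlk, hl⟩ := hψ.exists_list ⟨hs, hC⟩ h0 h1
        (fun i => ⟨v / 5 / A.size ^ (i : ℕ) % A.size, Nat.mod_lt _ A.size_pos⟩) (hS _)
      -- The at most `q` required indices are padded with the index `0` to a full tuple.
      obtain ⟨u, hu, hau, hI⟩ := hag (fun j => l.getD j 0) fun j => by
        rcases lt_or_ge (j : ℕ) l.length with hj | hj
        · simp only [List.getD_eq_getElem _ _ hj]
          exact hlk _ (List.getElem_mem _)
        · simp only [List.getD_eq_default _ _ hj]
          omega
      refine ⟨u, hu, hHE u hu, .inr ⟨by omega, hl u hau fun i hi => ?_⟩⟩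
      obtain ⟨j, hj, rfl⟩ := List.getElem_of_mem hi
      exact ⟨⟨j, by omega⟩, by rw [hI, List.getD_eq_getElem _ _ hj]⟩

end hitting

/-! ### The terms of the reduction -/

section terms

variable {α : Type} [Ctx α] {fn fk fT fu fv fw fe ff : α → ℕ}

theorem TmFun.codeBound (Q r : ℕ) (hn : TmFun fn) (hk : TmFun fk) :
    TmFun fun a => codeBound Q r (fn a) (fk a) :=
  ((hk.add (.const 2)).mul ((hn.pow r).add (.const 2))).pow Q

theorem TmFun.payloadBound (Q r m : ℕ) (hn : TmFun fn) (hk : TmFun fk) :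
    TmFun fun a => payloadBound Q r m (fn a) (fk a) :=
  (((TmFun.codeBound Q r hn hk).mul (TmFun.codeBound Q r hn hk)).mul (hn.pow m)).mul
    (((hk.add (.const 2)).pow Q).add (.const 2))

theorem TmRel.sameIdx (Q : ℕ) (hk : TmFun fk) (hT : TmFun fT) (hu : TmFun fu) (hv : TmFun fv) :
    TmRel fun a => SameIdx Q (fk a) (fT a) (fu a) (fv a) :=
  .finAll fun j => .eq (.pairIdx hk hT hu j) (.pairIdx hk hT hv j)

theorem TmRel.compatible (Q : ℕ) (hk : TmFun fk) (hT : TmFun fT) (hu : TmFun fu) (hv : TmFun fv) :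
    TmRel fun a => Compatible Q (fk a) (fT a) (fu a) (fv a) :=
  have hi {f : α → ℕ} (hf : TmFun f) := TmFun.pairIdx hk hT hf
  have hp {f : α → ℕ} (hf : TmFun f) := TmFun.pairVal hk hT hf
  .finAll fun j => .finAll fun j' =>
    ((TmRel.lt (hi hu j) (hi hv j')).iff (TmRel.lt (hp hu j) (hp hv j'))).and
      ((TmRel.lt (hi hv j') (hi hu j)).iff (TmRel.lt (hp hv j') (hp hu j)))

theorem TmRel.chainSet (Q : ℕ) (hk : TmFun fk) (hT : TmFun fT) (he : TmFun fe) (hf : TmFun ff)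
    (hu : TmFun fu) : TmRel fun a => ChainSet Q (fk a) (fT a) (fe a) (ff a) (fu a) :=
  ((TmRel.sameIdx Q hk hT hu hf).and (TmRel.compatible Q hk hT hu he)).or
    ((TmRel.sameIdx Q hk hT hu he).and (TmRel.eq hu he).not)

theorem TmRel.setMem (Q r : ℕ) {m : ℕ} {hit : HitRel m} (hh : hit.IsTm) (hn : TmFun fn)
    (hk : TmFun fk) (hv : TmFun fv) (hu : TmFun fu) :
    TmRel fun a => SetMem Q r hit (Ctx.word a) (fn a) (fk a) (fv a) (fu a) :=
  have hE := TmFun.codeBound Q r hn hk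
  have hp := hv.div (TmFun.const 5)
  have h2 := TmRel.eq (hv.mod (.const 5)) (.const 2)
  (TmRel.lt hu hE).and
    ((h2.and (TmRel.chainSet Q hk (hn.pow r) (hp.mod hE) ((hp.div hE).mod hE) hu)).or
      (h2.not.and (hh hn hk hu fun i => (hp.div (hn.pow i)).mod hn)))

theorem TmRel.gadgetEdge {mem : α → ℕ → ℕ → Prop} (hv : TmFun fv) (hw : TmFun fw)
    (hm : TmRel fun a => mem a (fv a) (fw a / 5)) :
    TmRel fun a => gadgetEdge (mem a) (fv a) (fw a) :=
  have h5 := TmFun.const (α := α) 5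
  have hc {f : α → ℕ} (hf : TmFun f) (c : ℕ) : TmRel fun a => f a = c := .eq hf (.const c)
  have hv5 := hc (hv.mod h5)
  ((hv5 0).and ((hc (hw.mod h5) 1).and (.eq (hv.div h5) (hw.div h5)))).or
  ((((hv5 2).or (hv5 3)).and ((TmRel.le (hw.mod h5) (.const 1)).and hm)).or
  (((hv5 0).and (hc hw 4)).or (((hv5 1).and (hc hw 9)).or (((hc hv 9).and (hc hw 4)).or
  ((hv5 4).and ((hc hv 4).not.and ((hc hv 9).not.and (hc hw 4))))))))

theorem TmRel.graphBit {adj : α → ℕ → ℕ → Prop} (hn : TmFun fn) (hv : TmFun fv)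
    (hadj : ∀ {f g : α → ℕ}, TmFun f → TmFun g → TmRel fun a => adj a (f a) (g a)) :
    TmRel fun a => graphBit (fn a) (adj a) (fv a) :=
  have hp := hv.sub (hn.add (TmFun.const 1))
  (TmRel.lt hv hn).or ((TmRel.lt hn hv).and (hadj (hp.mod hn) ((hp.div hn).mod hn)))

end terms

/-- The number of leading letters `1` of a word `w` of length `l`. -/
noncomputable def leadingOnes (w : ℕ → ℕ) (l : ℕ) : ℕ :=
  open Classical in ∑ i ∈ Finset.range l, if ∀ j < i + 1, w j = 1 then 1 else 0

theorem leadingOnes_eq {w : ℕ → ℕ} {l n : ℕ} (hn : n < l) (h1 : ∀ i < n, w i = 1) (h0 : w n = 0) :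
    leadingOnes w l = n := by
  classical
  have h : (Finset.range l).filter (fun i => ∀ j < i + 1, w j = 1) = Finset.range n := by
    ext i
    simp only [Finset.mem_filter, Finset.mem_range]
    constructor
    · rintro ⟨-, h⟩
      by_contra hi
      have := h n (by omega)
      omega
    · exact fun hi => ⟨by omega, fun j hj => h1 j (by omega)⟩
  rw [leadingOnes, Finset.sum_boole, h, Finset.card_range, Nat.cast_id]

/-- The word `w` of length `l` encodes a structure. -/
def ValidWord (τ : Vocab) (w : ℕ → ℕ) (l : ℕ) : Prop :=
  0 < leadingOnes w l ∧ (∀ i < leadingOnes w l, w i = 1) ∧ w (leadingOnes w l) = 0 ∧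
    l = leadingOnes w l + 1 + ∑ i, tableLength τ (leadingOnes w l) i

theorem TmFun.leadingOnes {α : Type} [Ctx α] {f : α → ℕ} (hf : TmFun f) :
    TmFun fun a => leadingOnes (Ctx.word a) (f a) := by
  refine (hf.sum (g := fun a i => open Classical in
    if ∀ j < i + 1, Ctx.word a j = 1 then 1 else 0) ?_).congr fun a => ?_
  · refine (TmFun.indicator (p := fun a : Ext α => ∀ j < a.snd + 1, Ctx.word a.fst j = 1) ?_).congr
      fun a => by congr
    exact TmRel.all (p := fun (a : Ext α) j => Ctx.word a.fst j = 1) (TmFun.snd.add (.const 1))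
      (TmRel.eq (TmFun.word TmFun.snd) (.const 1))
  · rfl

theorem TmRel.validWord {α : Type} [Ctx α] (τ : Vocab) {f : α → ℕ} (hf : TmFun f) :
    TmRel fun a => ValidWord τ (Ctx.word a) (f a) :=
  have hl := hf.leadingOnes
  (TmRel.lt (.const 0) hl).and ((TmRel.all (p := fun a i => Ctx.word a i = 1) hl
    (TmRel.eq (TmFun.word TmFun.snd) (.const 1))).and ((TmRel.eq hl.word (.const 0)).and
    (TmRel.eq hf ((hl.add (.const 1)).add (TmFun.finsetSum Finset.univ fun i =>
      hl.pow (τ.arity i))))))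

theorem getD_map_val (x : List (Fin 2)) (i : ℕ) :
    (x.map Fin.val).getD i 0 = (x.getD i 0 : Fin 2) :=
  List.getD_map (f := Fin.val) (d := (0 : Fin 2)) ..

theorem FinStruct.leadingOnes_word {τ : Vocab} (A : FinStruct τ) :
    leadingOnes A.word A.encode.length = A.size := by
  refine leadingOnes_eq (by rw [A.length_encode]; omega) (fun i hi => ?_) ?_
  · rw [FinStruct.word, getD_map_val, A.getD_encode_of_lt hi]
    rfl
  · rw [FinStruct.word, getD_map_val, A.getD_encode_size]
    rfl

theorem validWord_iff {τ : Vocab} (x : List (Fin 2)) (k : ℕ) :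
    ValidWord τ (Ctx.word (x, k)) x.length ↔ ∃ A : FinStruct τ, x = A.encode := by
  have hw : ∀ i, Ctx.word (x, k) i = (x.getD i 0 : Fin 2) := getD_map_val x
  constructor
  · rintro ⟨hn, h1, h0, hl⟩
    refine (exists_encode_eq_iff x).2 ⟨_, hn, fun i hi => Fin.ext ?_, Fin.ext ?_, hl⟩
    · rw [← hw, h1 i hi]
      rfl
    · rw [← hw, h0]
      rfl
  · rintro ⟨A, rfl⟩
    have hs : leadingOnes (Ctx.word (A.encode, k)) A.encode.length = A.size := A.leadingOnes_word
    unfold ValidWord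
    rw [hs]
    refine ⟨A.size_pos, fun i hi => ?_, ?_, A.length_encode⟩
    · rw [hw, A.getD_encode_of_lt hi]
      rfl
    · rw [hw, A.getD_encode_size]
      rfl

/-! ### Hardness -/

theorem rel_graphOf_iff {N : ℕ} {hN : 0 < N} {E : ℕ → ℕ → Prop}
    (x y : Fin (graphOf N hN E).size) :
    (graphOf N hN E).rel (0 : Fin 1) ![x, y] = true ↔ E x y := by
  classical
  exact decide_eq_true_iff

/-- The vertex deletion problem of `phiAEA` is hard for `W[2]` on every class of graphs that
includes the basic graphs. -/
theorem isWTwoHard_vdOn_phiAEA {P : FinStruct graphVocab → Prop}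
    (hP : ∀ (G : FinStruct graphVocab), (∀ x y, G.rel (0 : Fin 1) ![x, y] = true →
      G.rel (0 : Fin 1) ![y, x] = true ∧ x ≠ y) → P G) : IsWTwoHard (vdOn P phiAEA) := by
  classical
  rintro s' Q₀ ⟨τ, r, hr, φ, ⟨a, e, hφ⟩, hQ₀⟩
  obtain ⟨m, ψ, hψ, hcl⟩ := exists_universal_closure hφ
  obtain ⟨q, hq⟩ := exists_witnesses hψ
  obtain ⟨hit, hw⟩ := hq (q + 1)
  let Z := List (Fin 2) × ℕ
  let size : Z → ℕ := fun z => leadingOnes (Ctx.word z) z.1.length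
  let N : Z → ℕ := fun z => 5 * payloadBound (q + 1) r m (size z) z.2
  let adj : Z → ℕ → ℕ → Prop := fun z =>
    gadgetAdj (SetMem (q + 1) r hit (Ctx.word z) (size z) z.2)
  have hsize : TmFun size := TmFun.length.leadingOnes
  have hN : TmFun N := (TmFun.const 5).mul (hsize.payloadBound _ _ _ .param)
  -- The new parameter depends on `k` alone, since `q` is determined by the formula. Malformed words
  -- are sent to the empty word.
  refine hQ₀.trans_terms (K := fun k => (k + 2) ^ (q + 1))
    (L := fun z => if ValidWord τ (Ctx.word z) z.1.length then N z + 1 + N z ^ 2 else 0)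
    (bit := fun z => graphBit (N z) (adj z)) (.ite (.validWord τ .length)
      ((hN.add (.const 1)).add (hN.pow 2)) (.const 0)) ?_ ((TmFun.param.add (.const 2)).pow _)
    (fun k k' h => Nat.pow_le_pow_left (by omega) _) ?_ ?_
  · refine TmRel.graphBit (adj := fun a : Ext Z => adj a.fst) hN.weaken .snd fun hf hg => ?_
    have hmem := fun {f g : Ext Z → ℕ} (hf : TmFun f) (hg : TmFun g) =>
      TmRel.setMem (q + 1) r hw.isTm hsize.weaken TmFun.param.weaken hf (hg.div (.const 5))
    exact (TmRel.gadgetEdge (mem := fun a : Ext Z => SetMem (q + 1) r hit (Ctx.word a.fst)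
      (size a.fst) a.fst.2) hf hg (hmem hf hg)).or (TmRel.gadgetEdge hg hf (hmem hg hf))
  · have hpow : ∀ e : ℕ, Computable fun k : ℕ => (k + 2) ^ e := by
      intro e
      induction e with
      | zero => exact (Computable.const 1).of_eq fun n => by simp
      | succ e ih =>
        exact (Primrec.nat_mul.to_comp.comp ih
          (Primrec.nat_add.to_comp.comp Computable.id (Computable.const 2))).of_eq fun n => rfl
    exact hpow _
  · rintro ⟨x, k⟩
    by_cases hx : ∃ A : FinStruct τ, x = A.encode
    · rw [if_pos ((validWord_iff x k).2 hx)]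
      obtain ⟨A, rfl⟩ := hx
      have hs : size (A.encode, k) = A.size := A.leadingOnes_word
      have hN0 : 2 ≤ payloadBound (q + 1) r m (size (A.encode, k)) k :=
        two_le_payloadBound (hs ▸ A.size_pos)
      have hWD : (A.encode, k) ∈ weightedDefinability φ ↔
          ∃ S : Finset (Fin r → Fin A.size), S.card = k ∧ ∀ v, RealizeAt A S ψ v := by
        simp only [← hcl, ← expand_models_iff]
        constructor
        · rintro ⟨A', hA, hS⟩
          obtain rfl := FinStruct.encode_injective _ hA
          exact hS
        · exact fun hS => ⟨A, rfl, hS⟩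
      rw [hWD, ← exists_hitting_iff hw A k]
      rw [graphOf_mem_vdOn_iff (by simp only [N]; omega) (hP _ fun x y h => ?_)]
      · rw [exists_satAEA_iff hN0 fun v _ hv => exists_copies (hs ▸ A.size_pos) v hv]
        simp only [hs]
        rfl
      · have h' := (rel_graphOf_iff x y).1 h
        exact ⟨(rel_graphOf_iff y x).2 (gadgetAdj_symm h'),
          fun hxy => gadgetAdj_ne h' (congrArg Fin.val hxy)⟩
    · rw [if_neg ((validWord_iff x k).not.2 hx)]
      refine iff_of_false ?_ (bitWord_zero_notMem_vdOn _ _)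
      rintro ⟨A, hA, -⟩
      exact hx ⟨A, hA⟩

end VertexDeletion

-- The graphs produced are basic, hence also undirected, directed and arbitrary structures, so the
-- same hardness lemma applies four times.
open VertexDeletion in
theorem mainTheorem4 :
    (vdBasic phiAEA ∈ classBasic [Quant.a, Quant.e, Quant.a] ∧ IsWTwoHard (vdBasic phiAEA)) ∧
    (vdUndir phiAEA ∈ classUndir [Quant.a, Quant.e, Quant.a] ∧ IsWTwoHard (vdUndir phiAEA)) ∧
    (vdDir phiAEA ∈ classDir [Quant.a, Quant.e, Quant.a] ∧ IsWTwoHard (vdDir phiAEA)) ∧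
    (vdArb phiAEA ∈ classArb [Quant.a, Quant.e, Quant.a] ∧ IsWTwoHard (vdArb phiAEA)) :=
  ⟨⟨⟨_, phiAEA_hasPattern, rfl⟩, isWTwoHard_vdOn_phiAEA fun _ h => models_phiBasic_of h⟩,
    ⟨⟨_, phiAEA_hasPattern, rfl⟩,
      isWTwoHard_vdOn_phiAEA fun _ h => models_phiUndirected_of fun x y hxy => (h x y hxy).1⟩,
    ⟨⟨_, phiAEA_hasPattern, rfl⟩, isWTwoHard_vdOn_phiAEA fun _ _ => trivial⟩,
    ⟨⟨_, _, phiAEA_hasPattern, rfl⟩, isWTwoHard_vdOn_phiAEA fun _ _ => trivial⟩⟩
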